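/- Let $N\ge 0$ and $n\ge 1$ be integers, let $X$ be a connected open subset of $\mathbb C^N$, and let $\overline X$ be its closure in $\mathbb C^N$. Assume that the boundary $\partial X=\overline X\setminus X$ is $\mathcal C^0$ smooth, i.e., each $\xi\in\partial X$ has a neighborhood in $\overline X$ which is homeomorphic to a set of the form $U\cap\{(x_1,\dots,x_{2N})\in\mathbb R^{2N} : x_1\ge 0\}$, where $U\subseteq\mathbb R^{2N}$ is open. Let $A:\overline X\to \mathrm{Mat}(n\times n,\mathbb C)$ be continuous on $\overline X$ and holomorphic in $X$. A point $\xi\in\overline X$ is called a splitting point of the eigenvalues of $A$ if each neighborhood of $\xi$ in $\overline X$ contains a point $\zeta$ such that $A(\zeta)$ has more eigenvalues (not counting multiplicities) than $A(\xi)$. A point $\xi\in\overline X$ is called Jordan stable for $A$ if it is not a splitting point of the eigenvalues of $A$ and there is a neighborhood $U$ of $\xi$ in $\overline X$ such that, for each $1\le k\le n$, the number of Jordan blocks of size $k$ in the Jordan normal forms of $A(\zeta)$ is the same for all $\zeta\in U$. Let $\mathrm{Jst}\,A\subseteq\overline X$ be the set of Jordan stable points of $A$. A closed analytic subset of $X$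 is a set $Y\subseteq X$ such that each point of $X$ has an open neighborhood $U\subseteq X$ for which $Y\cap U$ is the common zero set of finitely many holomorphic functions on $U$. Then $X\setminus \mathrm{Jst}\,A$ is a nowhere dense closed analytic subset of $X$, and $\overline X\setminus\mathrm{Jst}\,A$ is nowhere dense in $\overline X$. Moreover, if $\mathrm{Jst}\,A\ne\overline X$, then there exist finitely many functions $h_1,\dots,h_\ell:\overline X\to\mathbb C$, continuous on $\overline X$ and holomorphic in $X$, such that $$\overline X\setminus \mathrm{Jst}\,A=\{\zeta\in\overline X : h_1(\zeta)=\dots=h_\ell(\zeta)=0\}$$ and $$|h_j(\zeta)|\le (2n)^{2n^4}\,\|A(\zeta)\|^{2n^4}\quad\text{for all }\zeta\in\overline X\text{ and }1\le j\le\ell,$$ where $\|\cdot\|$ is the operator norm of matrices acting on the Euclidean space $\mathbb C^n$. -/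

import Mathlib

open Topology
open scoped Matrix.Norms.L2Operator

noncomputable section

/-! Norms of complex matrices are operator norms between Euclidean spaces (the scoped
`L2Operator` instances opened above). -/

/-- The number of eigenvalues of `Φ`, not counting multiplicities. -/
def numEigenvalues {n : ℕ} (Φ : Matrix (Fin n) (Fin n) ℂ) : ℕ :=
  (spectrum ℂ Φ).ncard

/-- The Jordan block of size `l` with eigenvalue `lam`: `lam` on the diagonal and `1` on the first
superdiagonal. -/
def jordanBlock (lam : ℂ) (l : ℕ) : Matrix (Fin l) (Fin l) ℂ :=
  fun i j => if i = j then lam else if (i : ℕ) + 1 = (j : ℕ) then 1 else 0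

/-- `Φ` is similar to a block diagonal matrix whose diagonal blocks are the `k` Jordan blocks with
eigenvalues `ev i` and (positive) sizes `sz i`. The bijection `e` numbers the rows of the
block diagonal matrix by `Fin n`. -/
def IsJordanNormalForm {n : ℕ} (Φ : Matrix (Fin n) (Fin n) ℂ)
    {k : ℕ} (ev : Fin k → ℂ) (sz : Fin k → ℕ) : Prop :=
  (∀ i, 1 ≤ sz i) ∧
    ∃ (e : (Σ i : Fin k, Fin (sz i)) ≃ Fin n) (T : Matrix (Fin n) (Fin n) ℂ),
      IsUnit T ∧
        T⁻¹ * Φ * T =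
          Matrix.reindex e e (Matrix.blockDiagonal' fun i => jordanBlock (ev i) (sz i))

/-- The number of Jordan blocks of size `l` in the Jordan normal forms of `Φ`. All Jordan normal
forms of `Φ` have the same number of such blocks, so the set below has exactly one element. -/
def numJordanBlocks {n : ℕ} (l : ℕ) (Φ : Matrix (Fin n) (Fin n) ℂ) : ℕ :=
  sInf {c : ℕ | ∃ (k : ℕ) (ev : Fin k → ℂ) (sz : Fin k → ℕ),
    IsJordanNormalForm Φ ev sz ∧ c = (Finset.univ.filter fun i => sz i = l).card}

/-- The splitting points of the eigenvalues of `A` on the topological space `S` (a subset of an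
ambient space, with the subspace topology). -/
def splittingPoints {T : Type*} [TopologicalSpace T] {n : ℕ} (S : Set T)
    (A : T → Matrix (Fin n) (Fin n) ℂ) : Set T :=
  {ξ | ξ ∈ S ∧ ∀ U ∈ 𝓝[S] ξ, ∃ ζ ∈ U ∩ S, numEigenvalues (A ξ) < numEigenvalues (A ζ)}

/-- The Jordan stable points of `A` on the topological space `S` (a subset of an ambient space,
with the subspace topology). -/
def jordanStablePoints {T : Type*} [TopologicalSpace T] {n : ℕ} (S : Set T)
    (A : T → Matrix (Fin n) (Fin n) ℂ) : Set T :=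
  {ξ | ξ ∈ S ∧ ξ ∉ splittingPoints S A ∧
    ∃ U ∈ 𝓝[S] ξ, ∀ ζ ∈ U ∩ S, ∀ l : ℕ, 1 ≤ l → l ≤ n →
      numJordanBlocks l (A ζ) = numJordanBlocks l (A ξ)}

/-- The closed half-space `{x₁ ≥ 0}` of `ℝ^{2N}` (coordinates are numbered from `0` here). -/
def closedHalfSpace (N : ℕ) : Set (EuclideanSpace ℝ (Fin (2 * N))) :=
  {x | ∀ i : Fin (2 * N), (i : ℕ) = 0 → 0 ≤ x i}

/-- The boundary `closure X \ X` of the open set `X` is `C⁰` smooth: each of its points has a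
neighbourhood in `closure X` which is homeomorphic to `U ∩ {x₁ ≥ 0}` for some open set `U` of
`ℝ^{2N}`. -/
def HasC0Boundary {N : ℕ} (X : Set (EuclideanSpace ℂ (Fin N))) : Prop :=
  ∀ ξ ∈ closure X \ X, ∃ V : Set (EuclideanSpace ℂ (Fin N)), V ⊆ closure X ∧
    V ∈ 𝓝[closure X] ξ ∧
    ∃ U : Set (EuclideanSpace ℝ (Fin (2 * N))), IsOpen U ∧
      Nonempty (V ≃ₜ (U ∩ closedHalfSpace N : Set (EuclideanSpace ℝ (Fin (2 * N)))))

/-- `Y` is a closed analytic subset of the open set `X`: near each point of `X`, it is the common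
zero set of finitely many holomorphic functions. -/
def IsClosedAnalyticSubset {N : ℕ} (X Y : Set (EuclideanSpace ℂ (Fin N))) : Prop :=
  Y ⊆ X ∧ ∀ ξ ∈ X, ∃ U : Set (EuclideanSpace ℂ (Fin N)), IsOpen U ∧ ξ ∈ U ∧ U ⊆ X ∧
    ∃ (l : ℕ) (f : Fin l → EuclideanSpace ℂ (Fin N) → ℂ),
      (∀ j, DifferentiableOn ℂ (f j) U) ∧ Y ∩ U = {ζ | ζ ∈ U ∧ ∀ j, f j ζ = 0}

/-- The part of `Y` in `S` is nowhere dense in `S` with its subspace topology. -/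
def NowhereDenseIn {T : Type*} [TopologicalSpace T] (S Y : Set T) : Prop :=
  IsNowhereDense ((fun x : S => (x : T)) ⁻¹' Y)

end

/-! Let `P = nilpotentPart Φ` be the value at `Φ` of the monic polynomial `p` with simple roots
exactly at the eigenvalues. On a Jordan block of size `s` the factor belonging to its eigenvalue is
the nilpotent shift and the other factors are invertible, so `rank (P ^ r)` is the sum of the
truncated differences `s - r`. Block counts are second differences of these ranks and conversely
determine them. Jordan stability thus concerns only the number of eigenvalues and the ranks of `P,
..., P ^ n`.

The Hankel determinant of the power traces `tr (Φ ^ (i + j))` of size `m` is nonzero when there are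
exactly `m` eigenvalues and zero when there are fewer (`det_traceHankel_ne_zero`,
`det_traceHankel_eq_zero`). When it is nonzero, Cramer's rule writes the coefficients of `p` as
quotients of polynomials in the entries of `Φ` (`nilpotentPart_eq_rationalNilpotentPart`).

Let `m` be the maximal number of eigenvalues on `X`. Although `P (A z)` may jump where eigenvalues
merge, it stays locally bounded, since `‖P‖ ≤ (2‖Φ‖) ^ m`. Multiplying a polynomial in `P` by the
square of the Hankel determinant therefore gives a function continuous on the closure and
holomorphic in `X` (`continuousOn_regularized`, `differentiableOn_regularized`). Applied to products
of minors of the powers of `P`, of sizes the maximal ranks, this yields finitely many functions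
whose common zeros are exactly the points that are not Jordan stable
(`exists_generic_jordanStructure`). The identity theorem on the connected set `X` gives density.
Homogeneity gives the growth bound, after scaling and multiplication by powers of entries of `A`. -/

/-! ### Existence of the Jordan normal form. -/

open Polynomial in
theorem exists_basis_quotient_jordanBlock (p : ℂ[X]) (mu : ℂ) (e : ℕ)
    (hp : Associated p (X - C mu)) :
    ∃ b : Module.Basis (Fin e) ℂ (ℂ[X] ⧸ (Submodule.span ℂ[X] {p ^ e})),
      ∀ j, (X : ℂ[X]) • b j = ∑ i, jordanBlock mu e i j • b i := by
  have hspan : Submodule.span ℂ[X] {p ^ e} = Ideal.span {(X - C mu) ^ e} :=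
    Ideal.span_singleton_eq_span_singleton.2 (hp.pow_pow)
  rw [hspan]
  set I : Ideal ℂ[X] := Ideal.span {(X - C mu) ^ e} with hI
  -- The exponents decrease with `j`, so `X - mu` sends `v j` to `v (j - 1)` and the ones land on
  -- the superdiagonal.
  let v : Fin e → ℂ[X] ⧸ I := fun j => Ideal.Quotient.mk I ((X - C mu) ^ (e - 1 - (j : ℕ)))
  have hsmul : ∀ (c : ℂ) (q : ℂ[X]), c • Ideal.Quotient.mk I q = Ideal.Quotient.mk I (C c * q) := by
    intro c q
    rw [← Polynomial.smul_eq_C_mul]; rfl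
  have hli : LinearIndependent ℂ v := by
    rw [Fintype.linearIndependent_iff]
    intro g hg i
    have h1 : Ideal.Quotient.mk I (∑ j : Fin e, C (g j) * (X - C mu) ^ (e - 1 - (j : ℕ))) = 0 := by
      rw [map_sum, ← hg]
      exact Finset.sum_congr rfl fun j _ => (hsmul _ _).symm
    rw [Ideal.Quotient.eq_zero_iff_mem, hI, Ideal.mem_span_singleton] at h1
    -- Translation by `mu` turns the generator into `X ^ e` and the combination into one of distinct
    -- monomials of degree below `e`, whose coefficients must vanish.
    have h2 := map_dvd (compRingHom (X + C mu)) h1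
    simp only [map_sum, map_mul, map_pow, map_sub, coe_compRingHom_apply, C_comp, X_comp,
      add_sub_cancel_right] at h2
    rw [X_pow_dvd_iff] at h2
    have h3 := h2 (e - 1 - (i : ℕ)) (by have := i.2; omega)
    simp only [finsetSum_coeff, coeff_C_mul, coeff_X_pow] at h3
    rw [Finset.sum_eq_single i] at h3
    · simpa using h3
    · intro j _ hj
      have : (e - 1 - (i : ℕ)) ≠ e - 1 - (j : ℕ) := by
        have := i.2; have := j.2
        intro h; apply hj; ext; omega
      simp [this]
    · simp
  have hcard : Fintype.card (Fin e) = Module.finrank ℂ (ℂ[X] ⧸ I) := by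
    rw [finrank_quotient_span_eq_natDegree]
    simp
  have hfin : Module.Finite ℂ (ℂ[X] ⧸ I) := by
    have hm : ((X - C mu) ^ e).Monic := (monic_X_sub_C mu).pow e
    exact hm.finite_quotient
  cases isEmpty_or_nonempty (Fin e) with
  | inl h =>
    have h0 : Module.finrank ℂ (ℂ[X] ⧸ I) = 0 := by rw [← hcard]; simp
    have := Module.finrank_zero_iff.1 h0
    exact ⟨Module.Basis.empty _, fun j => h.elim j⟩
  | inr h =>
    refine ⟨basisOfLinearIndependentOfCardEqFinrank hli hcard, fun j => ?_⟩
    simp only [coe_basisOfLinearIndependentOfCardEqFinrank]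
    have hX : (X : ℂ[X]) • v j = mu • v j +
        Ideal.Quotient.mk I ((X - C mu) ^ (e - 1 - (j : ℕ) + 1)) := by
      change Ideal.Quotient.mk I (X * _) = _
      rw [hsmul, ← map_add]
      congr 1
      ring
    rw [hX]
    by_cases hj : (j : ℕ) = 0
    · have hz : Ideal.Quotient.mk I ((X - C mu) ^ (e - 1 - (j : ℕ) + 1)) = 0 := by
        rw [Ideal.Quotient.eq_zero_iff_mem, hI, Ideal.mem_span_singleton]
        apply pow_dvd_pow
        have := j.2; omega
      rw [hz, add_zero, Finset.sum_eq_single j]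
      · simp [jordanBlock]
      · intro i _ hi
        simp [jordanBlock, hi, hj]
      · simp
    · let j' : Fin e := ⟨j - 1, by have := j.2; omega⟩
      have hne : j ≠ j' := by intro h; have := congrArg Fin.val h; simp [j'] at this; omega
      have hz : Ideal.Quotient.mk I ((X - C mu) ^ (e - 1 - (j : ℕ) + 1)) = v j' := by
        simp only [v, j']
        congr 2
        have := j.2; omega
      rw [hz, Finset.sum_eq_add_of_mem j j' (Finset.mem_univ _) (Finset.mem_univ _) hne]
      · have : (j' : ℕ) + 1 = j := by simp [j']; omega
        simp [jordanBlock, hne.symm, this]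
      · intro i _ hi
        have : ¬ (i : ℕ) + 1 = j := by
          intro h; apply hi.2; ext; simp [j']; omega
        simp [jordanBlock, hi.1, this]

theorem blockDiagonal'_submatrix_sigmaMap {o o' R : Type*} [DecidableEq o] [DecidableEq o'] [Zero R]
    {m : o → Type*} (M : ∀ i, Matrix (m i) (m i) R) (f : o' → o) (hf : Function.Injective f) :
    (Matrix.blockDiagonal' M).submatrix (fun x : (Σ i, m (f i)) => (⟨f x.1, x.2⟩ : Σ i, m i))
      (fun x : (Σ i, m (f i)) => (⟨f x.1, x.2⟩ : Σ i, m i)) =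
      Matrix.blockDiagonal' fun i => M (f i) := by
  ext ⟨k, i⟩ ⟨k', j⟩
  by_cases h : k = k'
  · subst h; simp [Matrix.blockDiagonal'_apply_eq]
  · rw [Matrix.submatrix_apply, Matrix.blockDiagonal'_apply_ne _ _ _ (fun h' => h (hf h')),
      Matrix.blockDiagonal'_apply_ne _ _ _ h]

/-- The blocks of size zero can be dropped from a Jordan basis. -/
theorem exists_isJordanNormalForm_of_basis {n : ℕ} (Φ : Matrix (Fin n) (Fin n) ℂ) {ι : Type*}
    [Fintype ι] [DecidableEq ι] (ev : ι → ℂ) (sz : ι → ℕ)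
    (b : Module.Basis (Σ i, Fin (sz i)) ℂ (Fin n → ℂ))
    (hb : LinearMap.toMatrix b b (Matrix.toLin' Φ) =
      Matrix.blockDiagonal' fun i => jordanBlock (ev i) (sz i)) :
    ∃ (k : ℕ) (ev : Fin k → ℂ) (sz : Fin k → ℕ), IsJordanNormalForm Φ ev sz := by
  classical
  let φ : Fin (Fintype.card {i // sz i ≠ 0}) ≃ {i // sz i ≠ 0} := (Fintype.equivFin _).symm
  let f : Fin (Fintype.card {i // sz i ≠ 0}) → ι := fun k => φ k
  have hf : Function.Injective f := Subtype.val_injective.comp φ.injective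
  let τ : (Σ k, Fin (sz (f k))) → Σ i, Fin (sz i) := fun x => ⟨f x.1, x.2⟩
  have hτ : Function.Bijective τ := by
    constructor
    · rintro ⟨k, i⟩ ⟨k', j⟩ h
      have h1 : k = k' := hf (congrArg Sigma.fst h)
      subst h1
      simpa [τ] using h
    · rintro ⟨i, j⟩
      have hi : sz i ≠ 0 := by have := j.2; omega
      obtain ⟨k, hk⟩ := φ.surjective ⟨i, hi⟩
      have hk' : f k = i := congrArg Subtype.val hk
      subst hk'
      exact ⟨⟨k, j⟩, rfl⟩
  let e' := Equiv.ofBijective τ hτ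
  let b' := b.reindex e'.symm
  let e := b'.indexEquiv (Pi.basisFun ℂ (Fin n))
  have hb' : LinearMap.toMatrix b' b' (Matrix.toLin' Φ) =
      Matrix.blockDiagonal' fun k => jordanBlock (ev (f k)) (sz (f k)) := by
    rw [← blockDiagonal'_submatrix_sigmaMap (fun i => jordanBlock (ev i) (sz i)) f hf, ← hb]
    ext x y
    simp [LinearMap.toMatrix_apply, b', e', τ]
  let b'' := b'.reindex e
  have hb'' : LinearMap.toMatrix b'' b'' (Matrix.toLin' Φ) = Matrix.reindex e e
      (Matrix.blockDiagonal' fun k => jordanBlock (ev (f k)) (sz (f k))) := by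
    rw [← hb']
    ext x y
    simp [LinearMap.toMatrix_apply, b'']
  refine ⟨_, fun k => ev (f k), fun k => sz (f k), fun k => Nat.one_le_iff_ne_zero.2 (φ k).2, e,
    (Pi.basisFun ℂ (Fin n)).toMatrix b'', ?_, ?_⟩
  · exact IsUnit.of_mul_eq_one _ (Module.Basis.toMatrix_mul_toMatrix_flip _ _)
  · have hinv : ((Pi.basisFun ℂ (Fin n)).toMatrix b'')⁻¹ = b''.toMatrix (Pi.basisFun ℂ (Fin n)) :=
      Matrix.inv_eq_left_inv (Module.Basis.toMatrix_mul_toMatrix_flip _ _)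
    rw [hinv, ← hb'']
    have h := basis_toMatrix_mul_linearMap_toMatrix_mul_basis_toMatrix b'' (Pi.basisFun ℂ (Fin n))
      b'' (Pi.basisFun ℂ (Fin n)) (Matrix.toLin' Φ)
    rw [← h]
    congr 2
    exact (LinearMap.toMatrix'_toLin' Φ).symm

-- `ℂⁿ` with `X` acting as `Φ` is a torsion module over a principal ideal domain, hence a direct sum
-- of modules `ℂ[X] / (X - mu) ^ e`. The exponents may be zero, which is why empty blocks have to be
-- discarded.
open Polynomial in
theorem exists_isJordanNormalForm {n : ℕ} (Φ : Matrix (Fin n) (Fin n) ℂ) :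
    ∃ (k : ℕ) (ev : Fin k → ℂ) (sz : Fin k → ℕ), IsJordanNormalForm Φ ev sz := by
  classical
  let f := Matrix.toLin' Φ
  have htors : Module.IsTorsion ℂ[X] (Module.AEval' f) :=
    Module.AEval.isTorsion_of_finiteDimensional ℂ (Fin n → ℂ) f
  obtain ⟨ι, hι, p, hp, e, ⟨l⟩⟩ := Module.equiv_directSum_of_isTorsion htors
  have hroot : ∀ i, ∃ mu : ℂ, Associated (p i) (X - C mu) := by
    intro i
    obtain ⟨mu, hmu⟩ := IsAlgClosed.exists_root (p i)
      (by rw [IsAlgClosed.degree_eq_one_of_irreducible ℂ (hp i)]; exact one_ne_zero)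
    exact ⟨mu, ((irreducible_X_sub_C mu).associated_of_dvd (hp i)
      (dvd_iff_isRoot.2 hmu)).symm⟩
  choose mu hmu using hroot
  choose b hb using fun i => exists_basis_quotient_jordanBlock (p i) (mu i) (e i) (hmu i)
  let B : Module.Basis (Σ i, Fin (e i)) ℂ
      (DirectSum ι fun i => ℂ[X] ⧸ Submodule.span ℂ[X] {p i ^ e i}) := DFinsupp.basis b
  let L : (Fin n → ℂ) ≃ₗ[ℂ] (DirectSum ι fun i => ℂ[X] ⧸ Submodule.span ℂ[X] {p i ^ e i}) :=
    (Module.AEval'.of f).trans (l.restrictScalars ℂ)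
  have hL : ∀ v, L (f v) = (X : ℂ[X]) • L v := by
    intro v
    change l (Module.AEval'.of f (f v)) = X • l (Module.AEval'.of f v)
    rw [← map_smul, Module.AEval'.X_smul_of]
  have hB : ∀ i j, B ⟨i, j⟩ = DirectSum.of _ i (b i j) := by
    intro i j
    change (DFinsupp.mapRange.linearEquiv fun i => (b i).repr).symm
      (sigmaFinsuppLequivDFinsupp ℂ (Finsupp.single ⟨i, j⟩ 1)) = _
    rw [LinearEquiv.symm_apply_eq]
    change sigmaFinsuppEquivDFinsupp (Finsupp.single _ _) =
      DFinsupp.mapRange (fun i x => (b i).repr x) (fun i => map_zero _) (DFinsupp.single i (b i j))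
    rw [DFinsupp.mapRange_single, sigmaFinsuppEquivDFinsupp_single, Module.Basis.repr_self]
  refine exists_isJordanNormalForm_of_basis Φ mu e (B.map L.symm) ?_
  ext ⟨i, s⟩ ⟨j, t⟩
  have hcol : (X : ℂ[X]) • B ⟨j, t⟩ = ∑ s, jordanBlock (mu j) (e j) s t • B ⟨j, s⟩ := by
    simp only [hB]
    have : (X : ℂ[X]) • DirectSum.of (fun i => ℂ[X] ⧸ Submodule.span ℂ[X] {p i ^ e i}) j (b j t)
        = DirectSum.of (fun i => ℂ[X] ⧸ Submodule.span ℂ[X] {p i ^ e i}) j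
          ((X : ℂ[X]) • b j t) := (DFinsupp.single_smul _ _).symm
    rw [this, hb, map_sum]
    exact Finset.sum_congr rfl fun s _ => DFinsupp.single_smul _ _
  rw [LinearMap.toMatrix_apply]
  have : L (f (L.symm (B ⟨j, t⟩))) = ∑ s, jordanBlock (mu j) (e j) s t • B ⟨j, s⟩ := by
    rw [hL, LinearEquiv.apply_symm_apply, hcol]
  simp only [Module.Basis.map_apply, Module.Basis.map_repr, LinearEquiv.trans_apply,
    LinearEquiv.symm_symm]
  change B.repr (L (f (L.symm (B ⟨j, t⟩)))) ⟨i, s⟩ = _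
  rw [this, map_sum, Finsupp.finsetSum_apply]
  simp only [map_smul, Module.Basis.repr_self, Finsupp.smul_apply, Finsupp.single_apply]
  by_cases hij : i = j
  · subst hij
    simp [Matrix.blockDiagonal'_apply_eq]
  · rw [Matrix.blockDiagonal'_apply_ne _ _ _ hij]
    apply Finset.sum_eq_zero
    intro x _
    rw [if_neg]
    · simp
    · intro h; exact hij (congrArg Sigma.fst h).symm

/-! ### Ranks and traces of polynomials in a matrix, block by block. -/

open Polynomial in
theorem jordanBlock_sub_pow (mu : ℂ) (s k : ℕ) :
    (jordanBlock mu s - algebraMap ℂ _ mu) ^ k =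
      Matrix.of fun i j : Fin s => if (i : ℕ) + k = j then (1 : ℂ) else 0 := by
  have h1 : jordanBlock mu s - algebraMap ℂ _ mu =
      Matrix.of fun i j : Fin s => if (i : ℕ) + 1 = j then (1 : ℂ) else 0 := by
    ext i j
    rw [Matrix.sub_apply, Matrix.algebraMap_matrix_apply, Matrix.of_apply, jordanBlock]
    by_cases h : i = j
    · simp [h]
    · simp [h]
  induction k with
  | zero =>
    ext i j
    simp [Matrix.one_apply, Fin.ext_iff]
  | succ k ih =>
    rw [pow_succ', ih, h1]
    ext i j
    simp only [Matrix.mul_apply, Matrix.of_apply, ite_mul, one_mul, zero_mul]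
    by_cases hi : (i : ℕ) + 1 < s
    · rw [Finset.sum_eq_single ⟨i + 1, hi⟩]
      · simp [add_assoc, add_comm 1 k]
      · intro b _ hb
        rw [if_neg]
        intro h; exact hb (Fin.ext h.symm)
      · simp
    · rw [Finset.sum_eq_zero, if_neg]
      · have := j.2; omega
      · intro x _
        rw [if_neg]
        have := x.2; omega

/-- The power of the shift factors through `ℂ ^ (s - k)` and contains an identity submatrix of that
size. Truncated subtraction covers `k > s`. -/
theorem rank_jordanBlock_sub_pow (mu : ℂ) (s k : ℕ) :
    ((jordanBlock mu s - algebraMap ℂ _ mu) ^ k).rank = s - k := by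
  rw [jordanBlock_sub_pow]
  apply le_antisymm
  · have h : (Matrix.of fun i j : Fin s => if (i : ℕ) + k = j then (1 : ℂ) else 0) =
        (Matrix.of fun (i : Fin s) (x : Fin (s - k)) => if (i : ℕ) = x then (1 : ℂ) else 0) *
        (Matrix.of fun (x : Fin (s - k)) (j : Fin s) => if (x : ℕ) + k = j then (1 : ℂ) else 0) := by
      ext i j
      simp only [Matrix.mul_apply, Matrix.of_apply, ite_mul, one_mul, zero_mul]
      by_cases hi : (i : ℕ) < s - k
      · rw [Finset.sum_eq_single ⟨i, hi⟩]
        · simp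
        · intro b _ hb
          rw [if_neg]
          intro h; exact hb (Fin.ext h.symm)
        · simp
      · rw [Finset.sum_eq_zero, if_neg]
        · have := j.2; omega
        · intro x _
          rw [if_neg]
          have := x.2; omega
    rw [h]
    exact (Matrix.rank_mul_le_left _ _).trans (Matrix.rank_le_width _)
  · have h := Matrix.rank_submatrix_le
      (Matrix.of fun i j : Fin s => if (i : ℕ) + k = j then (1 : ℂ) else 0)
      (fun x : Fin (s - k) => ⟨x, by have := x.2; omega⟩)
      (fun x : Fin (s - k) => ⟨x + k, by have := x.2; omega⟩)
    refine le_trans (le_of_eq ?_) h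
    have : (Matrix.of fun i j : Fin s => if (i : ℕ) + k = j then (1 : ℂ) else 0).submatrix
      (fun x : Fin (s - k) => ⟨x, by have := x.2; omega⟩)
      (fun x : Fin (s - k) => ⟨x + k, by have := x.2; omega⟩) = 1 := by
      ext x y
      simp [Matrix.one_apply, Fin.ext_iff]
    rw [this, Matrix.rank_one, Fintype.card_fin]

theorem rank_blockDiagonal' {K o : Type*} [Field K] [Fintype o] [DecidableEq o] {m : o → Type*}
    [∀ i, Fintype (m i)] [∀ i, DecidableEq (m i)] (M : ∀ i, Matrix (m i) (m i) K) :
    (Matrix.blockDiagonal' M).rank = ∑ i, (M i).rank := by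
  have hM : ∀ v i j, (Matrix.blockDiagonal' M).mulVec v ⟨i, j⟩ =
      (M i).mulVec (fun j => v ⟨i, j⟩) j := by
    intro v i j
    simp only [Matrix.mulVec, dotProduct, ← Finset.univ_sigma_univ, Finset.sum_sigma]
    rw [Finset.sum_eq_single i]
    · simp [Matrix.blockDiagonal'_apply_eq]
    · intro b _ hb
      exact Finset.sum_eq_zero fun x _ => by
        rw [Matrix.blockDiagonal'_apply_ne _ _ _ hb.symm, zero_mul]
    · simp
  let E : LinearMap.range (Matrix.blockDiagonal' M).mulVecLin ≃ₗ[K]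
      (∀ i, LinearMap.range (M i).mulVecLin) :=
    LinearEquiv.ofBijective
      (LinearMap.pi fun i => LinearMap.codRestrict _
        ((LinearMap.funLeft K K (fun j => (⟨i, j⟩ : Σ i, m i))).comp (Submodule.subtype _))
        (by
          rintro ⟨_, v, rfl⟩
          exact ⟨fun j => v ⟨i, j⟩, funext fun j => (hM v i j).symm⟩))
      (by
        constructor
        · rintro ⟨v, hv⟩ ⟨w, hw⟩ h
          ext ⟨i, j⟩
          exact congrFun (congrArg Subtype.val (congrFun h i)) j
        · intro w
          choose v hv using fun i => (w i).2
          refine ⟨⟨_, fun x => v x.1 x.2, rfl⟩, ?_⟩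
          ext i j
          change (Matrix.blockDiagonal' M).mulVec _ ⟨i, j⟩ = _
          rw [hM, ← hv i]
          rfl)
  rw [Matrix.rank, E.finrank_eq, Module.finrank_pi_fintype]
  rfl

/-- A Jordan normal form of `Φ` embeds the algebra of block diagonal matrices so that the
tuple of Jordan blocks is sent to `Φ`. -/
theorem IsJordanNormalForm.exists_algHom {n k : ℕ} {Φ : Matrix (Fin n) (Fin n) ℂ} {ev : Fin k → ℂ}
    {sz : Fin k → ℕ} (h : IsJordanNormalForm Φ ev sz) :
    ∃ Ψ : (∀ i, Matrix (Fin (sz i)) (Fin (sz i)) ℂ) →ₐ[ℂ] Matrix (Fin n) (Fin n) ℂ,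
      Ψ (fun i => jordanBlock (ev i) (sz i)) = Φ ∧
      (∀ M, (Ψ M).rank = ∑ i, (M i).rank) ∧ (∀ M, (Ψ M).trace = ∑ i, (M i).trace) := by
  obtain ⟨-, e, T, hT, hΦ⟩ := h
  have hdet : IsUnit T.det := (Matrix.isUnit_iff_isUnit_det T).1 hT
  have hdet' : IsUnit (T⁻¹).det := Matrix.isUnit_nonsing_inv_det T hdet
  let B : (∀ i, Matrix (Fin (sz i)) (Fin (sz i)) ℂ) →ₐ[ℂ]
      Matrix (Σ i, Fin (sz i)) (Σ i, Fin (sz i)) ℂ :=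
    AlgHom.mk' (Matrix.blockDiagonal'RingHom (fun i => Fin (sz i)) ℂ)
      (fun c M => Matrix.blockDiagonal'_smul c M)
  let C : Matrix (Fin n) (Fin n) ℂ →ₐ[ℂ] Matrix (Fin n) (Fin n) ℂ :=
    AlgHom.ofLinearMap
      ((LinearMap.mulRight ℂ T⁻¹).comp (LinearMap.mulLeft ℂ T))
      (by simp [Matrix.mul_nonsing_inv T hdet])
      (fun x y => by
        simp only [LinearMap.comp_apply, LinearMap.mulLeft_apply, LinearMap.mulRight_apply]
        calc T * (x * y) * T⁻¹ = T * x * 1 * y * T⁻¹ := by simp only [mul_assoc, one_mul]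
          _ = _ := by rw [← Matrix.nonsing_inv_mul T hdet]; simp only [mul_assoc])
  have hC : ∀ M, C M = T * M * T⁻¹ := fun M => rfl
  let R := (Matrix.reindexAlgEquiv ℂ ℂ e).toAlgHom
  have hΨ : ∀ M, (C.comp (R.comp B)) M = T * Matrix.reindex e e (Matrix.blockDiagonal' M) * T⁻¹ :=
    fun M => rfl
  refine ⟨C.comp (R.comp B), ?_, ?_, ?_⟩
  · rw [hΨ, ← hΦ]
    simp only [← mul_assoc, Matrix.mul_nonsing_inv T hdet, one_mul]
    rw [mul_assoc, Matrix.mul_nonsing_inv T hdet, mul_one]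
  · intro M
    rw [hΨ, Matrix.rank_mul_eq_left_of_isUnit_det _ _ hdet',
      Matrix.rank_mul_eq_right_of_isUnit_det _ _ hdet, Matrix.rank_reindex, rank_blockDiagonal']
  · intro M
    rw [hΨ, Matrix.trace_mul_comm, ← mul_assoc, Matrix.nonsing_inv_mul T hdet, one_mul]
    rw [← Matrix.trace_blockDiagonal']
    simp [Matrix.trace, Matrix.reindex_apply, ← Equiv.sum_comp e]

theorem IsJordanNormalForm.sum_sz {n k : ℕ} {Φ : Matrix (Fin n) (Fin n) ℂ} {ev : Fin k → ℂ}
    {sz : Fin k → ℕ} (h : IsJordanNormalForm Φ ev sz) : ∑ i, sz i = n := by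
  obtain ⟨-, e, -⟩ := h
  have := Fintype.card_congr e
  simpa using this

open Polynomial in
theorem IsJordanNormalForm.rank_aeval_eq_sum {n k : ℕ} {Φ : Matrix (Fin n) (Fin n) ℂ}
    {ev : Fin k → ℂ} {sz : Fin k → ℕ} (h : IsJordanNormalForm Φ ev sz) (g : ℂ[X]) :
    (aeval Φ g).rank = ∑ i, (aeval (jordanBlock (ev i) (sz i)) g).rank := by
  obtain ⟨Ψ, hΨ, hr, -⟩ := h.exists_algHom
  have : aeval Φ g = Ψ (fun i => aeval (jordanBlock (ev i) (sz i)) g) := by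
    rw [← hΨ, aeval_algHom_apply]
    congr 1
    ext1 i
    exact (aeval_algHom_apply (Pi.evalAlgHom ℂ _ i) _ g).symm
  rw [this, hr]

open Polynomial in
theorem IsJordanNormalForm.trace_aeval_eq_sum {n k : ℕ} {Φ : Matrix (Fin n) (Fin n) ℂ}
    {ev : Fin k → ℂ} {sz : Fin k → ℕ} (h : IsJordanNormalForm Φ ev sz) (g : ℂ[X]) :
    (aeval Φ g).trace = ∑ i, (aeval (jordanBlock (ev i) (sz i)) g).trace := by
  obtain ⟨Ψ, hΨ, -, ht⟩ := h.exists_algHom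
  have : aeval Φ g = Ψ (fun i => aeval (jordanBlock (ev i) (sz i)) g) := by
    rw [← hΨ, aeval_algHom_apply]
    congr 1
    ext1 i
    exact (aeval_algHom_apply (Pi.evalAlgHom ℂ _ i) _ g).symm
  rw [this, ht]

theorem jordanBlock_sub_isNilpotent (mu : ℂ) (s : ℕ) :
    IsNilpotent (jordanBlock mu s - algebraMap ℂ _ mu) := by
  refine ⟨s, ?_⟩
  rw [jordanBlock_sub_pow]
  ext i j
  have := j.2
  simp only [Matrix.of_apply, Matrix.zero_apply, ite_eq_right_iff, one_ne_zero, imp_false]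
  omega

-- `g - g(mu)` is divisible by `X - mu`, so it takes a nilpotent value at the block and contributes
-- no trace.
open Polynomial in
theorem trace_aeval_jordanBlock (mu : ℂ) (s : ℕ) (g : ℂ[X]) :
    (aeval (jordanBlock mu s) g).trace = s * g.eval mu := by
  obtain ⟨q, hq⟩ := X_sub_C_dvd_sub_C_eval (a := mu) (p := g)
  have hg : g = C (g.eval mu) + (X - C mu) * q := by rw [← hq]; ring
  have hnil : IsNilpotent ((jordanBlock mu s - algebraMap ℂ _ mu) * aeval (jordanBlock mu s) q) := by
    have hc : Commute (jordanBlock mu s - algebraMap ℂ _ mu) (aeval (jordanBlock mu s) q) := by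
      have := Commute.all (X - C mu) q |>.map (aeval (jordanBlock mu s))
      simpa using this
    exact hc.isNilpotent_mul_right (jordanBlock_sub_isNilpotent mu s)
  have h0 := (Matrix.isNilpotent_trace_of_isNilpotent hnil).eq_zero
  have h1 : aeval (jordanBlock mu s) g = algebraMap ℂ _ (g.eval mu) +
      (jordanBlock mu s - algebraMap ℂ _ mu) * aeval (jordanBlock mu s) q := by
    conv_lhs => rw [hg]
    simp
  rw [h1, Matrix.trace_add, h0, add_zero, Matrix.algebraMap_eq_diagonal]
  simp [Matrix.trace]

open Polynomial in
theorem isUnit_aeval_jordanBlock (mu : ℂ) (s : ℕ) (g : ℂ[X]) (hg : g.eval mu ≠ 0) :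
    IsUnit (aeval (jordanBlock mu s) g) := by
  obtain ⟨N, hN⟩ := jordanBlock_sub_isNilpotent mu s
  have hcop : IsCoprime ((X - C mu) ^ N) g := by
    apply IsCoprime.pow_left
    rw [(irreducible_X_sub_C mu).coprime_iff_not_dvd, dvd_iff_isRoot]
    exact hg
  obtain ⟨a, b, hab⟩ := hcop
  have h := congrArg (aeval (jordanBlock mu s)) hab
  have h2 : aeval (jordanBlock mu s) b * aeval (jordanBlock mu s) g = 1 := by
    simpa [hN] using h
  exact IsUnit.of_mul_eq_one_right _ h2

open Polynomial in
theorem IsJordanNormalForm.mem_spectrum_iff {n k : ℕ} {Φ : Matrix (Fin n) (Fin n) ℂ}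
    {ev : Fin k → ℂ} {sz : Fin k → ℕ} (h : IsJordanNormalForm Φ ev sz) (mu : ℂ) :
    mu ∈ spectrum ℂ Φ ↔ ∃ i, ev i = mu := by
  have hr := h.rank_aeval_eq_sum (X - C mu)
  have hsz := h.sum_sz
  have hunit : mu ∈ spectrum ℂ Φ ↔ (aeval Φ (X - C mu)).rank ≠ n := by
    rw [spectrum.mem_iff, not_iff_not]
    have : algebraMap ℂ _ mu - Φ = -(aeval Φ (X - C mu)) := by simp
    rw [this, IsUnit.neg_iff]
    constructor
    · intro hu; simpa using Matrix.rank_of_isUnit _ hu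
    · intro hu
      have := Matrix.mulVec_surjective_iff_isUnit (A := aeval Φ (X - C mu))
      rw [← this]
      have ht : LinearMap.range (aeval Φ (X - C mu)).mulVecLin = ⊤ := by
        apply Submodule.eq_top_of_finrank_eq
        rw [Module.finrank_fin_fun]
        exact hu
      exact LinearMap.range_eq_top.1 ht
  rw [hunit]
  constructor
  · intro hne
    by_contra! hcon
    apply hne
    rw [hr]
    refine (Finset.sum_congr rfl fun i _ => ?_).trans hsz
    have hu := isUnit_aeval_jordanBlock (ev i) (sz i) (X - C mu)
      (by simpa [sub_eq_zero] using hcon i)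
    rw [Matrix.rank_of_isUnit _ hu, Fintype.card_fin]
  · rintro ⟨i, rfl⟩
    apply ne_of_lt
    rw [hr]
    refine lt_of_lt_of_eq
      (Finset.sum_lt_sum (fun j _ => Matrix.rank_le_width _) ⟨i, Finset.mem_univ _, ?_⟩) hsz
    have := rank_jordanBlock_sub_pow (ev i) (sz i) 1
    have h1 := h.1 i
    simp only [pow_one] at this
    simp only [map_sub, aeval_X, aeval_C, this]
    omega

/-! ### The nilpotent part and the Jordan block counts. -/

open Polynomial in
/-- The monic polynomial whose roots are the eigenvalues of `Φ`, all of them simple. -/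
noncomputable def spectralPolynomial {n : ℕ} (Φ : Matrix (Fin n) (Fin n) ℂ) : ℂ[X] :=
  ∏ mu ∈ (Matrix.finite_spectrum Φ).toFinset, (X - C mu)

/-- The spectral polynomial of `Φ`, evaluated at `Φ`. -/
noncomputable def nilpotentPart {n : ℕ} (Φ : Matrix (Fin n) (Fin n) ℂ) :
    Matrix (Fin n) (Fin n) ℂ :=
  Polynomial.aeval Φ (spectralPolynomial Φ)

open Polynomial in
theorem IsJordanNormalForm.rank_nilpotentPart_pow {n k : ℕ} {Φ : Matrix (Fin n) (Fin n) ℂ}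
    {ev : Fin k → ℂ} {sz : Fin k → ℕ} (h : IsJordanNormalForm Φ ev sz) (r : ℕ) :
    (nilpotentPart Φ ^ r).rank = ∑ i, (sz i - r) := by
  rw [nilpotentPart, ← map_pow, h.rank_aeval_eq_sum]
  refine Finset.sum_congr rfl fun i _ => ?_
  have hmem : ev i ∈ (Matrix.finite_spectrum Φ).toFinset := by
    simpa using (h.mem_spectrum_iff (ev i)).2 ⟨i, rfl⟩
  rw [spectralPolynomial, ← Finset.mul_prod_erase _ _ hmem, mul_pow, map_mul]
  have hu : IsUnit (aeval (jordanBlock (ev i) (sz i))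
      ((∏ mu ∈ (Matrix.finite_spectrum Φ).toFinset.erase (ev i), (X - C mu)) ^ r)) := by
    apply isUnit_aeval_jordanBlock
    rw [eval_pow, eval_prod]
    apply pow_ne_zero
    rw [Finset.prod_ne_zero_iff]
    intro mu hmu
    simpa [sub_eq_zero] using (Finset.ne_of_mem_erase hmu).symm
  rw [Matrix.rank_mul_eq_left_of_isUnit_det _ _ ((Matrix.isUnit_iff_isUnit_det _).1 hu)]
  have := rank_jordanBlock_sub_pow (ev i) (sz i) r
  simpa using this

/-- The second difference of `r ↦ max (s - r) 0` is the indicator of `s = l + 1`. The additive form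
avoids subtraction in `ℕ`. -/
theorem IsJordanNormalForm.card_add_two_mul_rank {n k : ℕ} {Φ : Matrix (Fin n) (Fin n) ℂ}
    {ev : Fin k → ℂ} {sz : Fin k → ℕ} (h : IsJordanNormalForm Φ ev sz) (l : ℕ) :
    (Finset.univ.filter fun i => sz i = l + 1).card + 2 * (nilpotentPart Φ ^ (l + 1)).rank =
      (nilpotentPart Φ ^ l).rank + (nilpotentPart Φ ^ (l + 2)).rank := by
  simp only [h.rank_nilpotentPart_pow, Finset.card_filter, Finset.mul_sum,
    ← Finset.sum_add_distrib]
  refine Finset.sum_congr rfl fun i _ => ?_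
  split_ifs <;> omega

theorem numJordanBlocks_eq_card {n k : ℕ} {Φ : Matrix (Fin n) (Fin n) ℂ}
    {ev : Fin k → ℂ} {sz : Fin k → ℕ} (h : IsJordanNormalForm Φ ev sz) {l : ℕ} (hl : 1 ≤ l) :
    numJordanBlocks l Φ = (Finset.univ.filter fun i => sz i = l).card := by
  obtain ⟨l, rfl⟩ := Nat.exists_eq_add_of_le' hl
  have : {c : ℕ | ∃ (k : ℕ) (ev : Fin k → ℂ) (sz : Fin k → ℕ),
      IsJordanNormalForm Φ ev sz ∧ c = (Finset.univ.filter fun i => sz i = l + 1).card} =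
      {(Finset.univ.filter fun i => sz i = l + 1).card} := by
    ext c
    simp only [Set.mem_ofPred_eq, Set.mem_singleton_iff]
    constructor
    · rintro ⟨k', ev', sz', h', rfl⟩
      have h1 := h.card_add_two_mul_rank l
      have h2 := h'.card_add_two_mul_rank l
      omega
    · rintro rfl
      exact ⟨k, ev, sz, h, rfl⟩
  rw [numJordanBlocks, this, csInf_singleton]

theorem numJordanBlocks_add_two_mul_rank {n : ℕ} (Φ : Matrix (Fin n) (Fin n) ℂ) (l : ℕ) :
    numJordanBlocks (l + 1) Φ + 2 * (nilpotentPart Φ ^ (l + 1)).rank =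
      (nilpotentPart Φ ^ l).rank + (nilpotentPart Φ ^ (l + 2)).rank := by
  obtain ⟨k, ev, sz, h⟩ := exists_isJordanNormalForm Φ
  rw [numJordanBlocks_eq_card h (by omega), h.card_add_two_mul_rank]

theorem IsJordanNormalForm.sz_le {n k : ℕ} {Φ : Matrix (Fin n) (Fin n) ℂ}
    {ev : Fin k → ℂ} {sz : Fin k → ℕ} (h : IsJordanNormalForm Φ ev sz) (i : Fin k) : sz i ≤ n := by
  rw [← h.sum_sz]
  exact Finset.single_le_sum (f := sz) (fun _ _ => Nat.zero_le _) (Finset.mem_univ i)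

theorem rank_nilpotentPart_pow_eq_sum {n : ℕ} (Φ : Matrix (Fin n) (Fin n) ℂ) (r : ℕ) :
    (nilpotentPart Φ ^ r).rank = ∑ l ∈ Finset.Icc 1 n, numJordanBlocks l Φ * (l - r) := by
  obtain ⟨k, ev, sz, h⟩ := exists_isJordanNormalForm Φ
  rw [h.rank_nilpotentPart_pow]
  have : ∀ l ∈ Finset.Icc 1 n, numJordanBlocks l Φ * (l - r) =
      ∑ i, if sz i = l then l - r else 0 := by
    intro l hl
    rw [numJordanBlocks_eq_card h (Finset.mem_Icc.1 hl).1, Finset.card_filter, Finset.sum_mul]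
    refine Finset.sum_congr rfl fun i _ => ?_
    split_ifs <;> simp
  rw [Finset.sum_congr rfl this, Finset.sum_comm]
  refine Finset.sum_congr rfl fun i _ => ?_
  rw [Finset.sum_ite_eq, if_pos]
  exact Finset.mem_Icc.2 ⟨h.1 i, h.sz_le i⟩

theorem rank_nilpotentPart_pow_of_le {n : ℕ} (Φ : Matrix (Fin n) (Fin n) ℂ) {r : ℕ} (hr : n ≤ r) :
    (nilpotentPart Φ ^ r).rank = 0 := by
  rw [rank_nilpotentPart_pow_eq_sum]
  apply Finset.sum_eq_zero
  intro l hl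
  rw [Nat.sub_eq_zero_of_le ((Finset.mem_Icc.1 hl).2.trans hr), mul_zero]

theorem isNilpotent_nilpotentPart {n : ℕ} (Φ : Matrix (Fin n) (Fin n) ℂ) :
    IsNilpotent (nilpotentPart Φ) := by
  refine ⟨n, ?_⟩
  have h := rank_nilpotentPart_pow_of_le Φ le_rfl
  rw [Matrix.rank, Submodule.finrank_eq_zero, LinearMap.range_eq_bot] at h
  ext i j
  simpa using congrFun (LinearMap.congr_fun h (Pi.single j 1)) i

/-! ### Power traces: counting eigenvalues and recovering the spectral polynomial. -/

/-- The `m × m` Hankel matrix of the power traces of `Φ`. -/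
noncomputable def traceHankel {n : ℕ} (m : ℕ) (Φ : Matrix (Fin n) (Fin n) ℂ) :
    Matrix (Fin m) (Fin m) ℂ :=
  Matrix.of fun i j => (Φ ^ ((i : ℕ) + j)).trace

theorem numEigenvalues_eq_card {n : ℕ} (Φ : Matrix (Fin n) (Fin n) ℂ) :
    numEigenvalues Φ = (Matrix.finite_spectrum Φ).toFinset.card :=
  Set.ncard_eq_toFinset_card _ _

theorem monic_spectralPolynomial {n : ℕ} (Φ : Matrix (Fin n) (Fin n) ℂ) :
    (spectralPolynomial Φ).Monic :=
  Polynomial.monic_prod_of_monic _ _ fun mu _ => Polynomial.monic_X_sub_C mu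

theorem natDegree_spectralPolynomial {n : ℕ} (Φ : Matrix (Fin n) (Fin n) ℂ) :
    (spectralPolynomial Φ).natDegree = numEigenvalues Φ := by
  rw [numEigenvalues_eq_card, spectralPolynomial, Polynomial.natDegree_prod_of_monic _ _
    fun mu _ => Polynomial.monic_X_sub_C mu]
  simp

theorem trace_mul_nilpotentPart {n : ℕ} (Φ : Matrix (Fin n) (Fin n) ℂ) (i : ℕ) :
    (Φ ^ i * nilpotentPart Φ).trace = 0 := by
  have hc : Commute (Φ ^ i) (nilpotentPart Φ) := by
    have := (Commute.all (Polynomial.X ^ i) (spectralPolynomial Φ)).map (Polynomial.aeval Φ)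
    simpa [nilpotentPart] using this
  exact (Matrix.isNilpotent_trace_of_isNilpotent
    (hc.isNilpotent_mul_left (isNilpotent_nilpotentPart Φ))).eq_zero

open Polynomial in
theorem traceHankel_mulVec_coeff {n m : ℕ} (Φ : Matrix (Fin n) (Fin n) ℂ) (f : ℂ[X])
    (hf : f.natDegree < m) (i : Fin m) :
    (traceHankel m Φ).mulVec (fun j : Fin m => f.coeff j) i =
      (Φ ^ (i : ℕ) * aeval Φ f).trace := by
  rw [aeval_eq_sum_range' hf, Finset.mul_sum, Matrix.trace_sum, Matrix.mulVec, dotProduct,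
    ← Fin.sum_univ_eq_sum_range (fun j => (Φ ^ (i : ℕ) * f.coeff j • Φ ^ j).trace)]
  refine Finset.sum_congr rfl fun j _ => ?_
  rw [mul_smul_comm, Matrix.trace_smul, ← pow_add, traceHankel, Matrix.of_apply, smul_eq_mul,
    mul_comm]

/-- The coefficient vector of the spectral polynomial lies in the kernel, because `Φ ^ i * P` is
nilpotent and so has trace zero. -/
theorem det_traceHankel_eq_zero {n m : ℕ} (Φ : Matrix (Fin n) (Fin n) ℂ)
    (h : numEigenvalues Φ < m) : (traceHankel m Φ).det = 0 := by
  rw [← Matrix.exists_mulVec_eq_zero_iff]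
  refine ⟨fun j => (spectralPolynomial Φ).coeff j, ?_, ?_⟩
  · intro h0
    have h1 := congrFun h0 ⟨numEigenvalues Φ, h⟩
    simp only [← natDegree_spectralPolynomial Φ, Polynomial.coeff_natDegree, Pi.zero_apply,
      (monic_spectralPolynomial Φ).leadingCoeff, one_ne_zero] at h1
  · ext i
    rw [traceHankel_mulVec_coeff _ _ (by rwa [natDegree_spectralPolynomial])]
    exact trace_mul_nilpotentPart Φ i

-- A kernel vector is a polynomial `f` of degree below `m` with `tr (g(Φ) f(Φ)) = 0` for all `g` of
-- degree below `m`. Testing with a `g` that isolates one eigenvalue shows that `f` vanishes there.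
-- Having `m` roots, `f` is zero.
open Polynomial in
theorem det_traceHankel_ne_zero {n m : ℕ} (Φ : Matrix (Fin n) (Fin n) ℂ)
    (hm : numEigenvalues Φ = m) : (traceHankel m Φ).det ≠ 0 := by
  intro hdet
  obtain ⟨v, hv0, hv⟩ := Matrix.exists_mulVec_eq_zero_iff.2 hdet
  apply hv0
  set s := (Matrix.finite_spectrum Φ).toFinset with hs
  have hcard : s.card = m := (numEigenvalues_eq_card Φ).symm.trans hm
  let f : ℂ[X] := ∑ j : Fin m, C (v j) * X ^ (j : ℕ)
  have hcoeff : ∀ j : Fin m, f.coeff j = v j := by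
    intro j
    simp only [f, finsetSum_coeff, coeff_C_mul, coeff_X_pow]
    rw [Finset.sum_eq_single j]
    · simp
    · intro b _ hb
      have : (j : ℕ) ≠ b := fun h => hb (Fin.ext h.symm)
      simp [this]
    · simp
  have hdeg : f.degree < m := degree_sum_fin_lt v
  have hcv : (fun j : Fin m => f.coeff j) = v := funext hcoeff
  suffices hf : f = 0 by
    rw [← hcv, hf]; ext; simp
  by_cases hm0 : m = 0
  · rw [hm0] at hdeg
    exact degree_eq_bot.1 (by simpa using hdeg)
  have hnat : f.natDegree < m := by
    by_cases hf0 : f = 0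
    · rw [hf0]; simp; omega
    · exact (natDegree_lt_iff_degree_lt hf0).2 hdeg
  have htr : ∀ i < m, (Φ ^ i * aeval Φ f).trace = 0 := by
    intro i hi
    have h := traceHankel_mulVec_coeff Φ f hnat ⟨i, hi⟩
    rw [hcv, hv] at h
    exact h.symm
  have htr' : ∀ g : ℂ[X], g.natDegree < m → (aeval Φ (g * f)).trace = 0 := by
    intro g hg
    rw [map_mul, aeval_eq_sum_range' hg, Finset.sum_mul, Matrix.trace_sum]
    refine Finset.sum_eq_zero fun i hi => ?_
    rw [smul_mul_assoc, Matrix.trace_smul, htr i (Finset.mem_range.1 hi), smul_zero]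
  obtain ⟨k, ev, sz, hJ⟩ := exists_isJordanNormalForm Φ
  refine eq_zero_of_degree_lt_of_eval_finset_eq_zero s (by rwa [hcard]) ?_
  intro mu hmu
  -- This product has degree `m - 1` and vanishes at every eigenvalue except `mu`.
  have hg : (∏ nu ∈ s.erase mu, (X - C nu)).natDegree < m := by
    rw [natDegree_prod_of_monic _ _ fun nu _ => monic_X_sub_C nu]
    simp only [natDegree_X_sub_C, Finset.sum_const, smul_eq_mul, mul_one,
      Finset.card_erase_of_mem hmu, hcard]
    omega
  have h0 := htr' _ hg
  rw [hJ.trace_aeval_eq_sum] at h0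
  have hterm : ∀ i, (aeval (jordanBlock (ev i) (sz i)) ((∏ nu ∈ s.erase mu, (X - C nu)) * f)).trace
      = ((if ev i = mu then sz i else 0 : ℕ) : ℂ) *
        ((∏ nu ∈ s.erase mu, (mu - nu)) * f.eval mu) := by
    intro i
    rw [trace_aeval_jordanBlock, eval_mul, eval_prod]
    split_ifs with hi
    · simp [hi]
    · have : ∏ nu ∈ s.erase mu, eval (ev i) (X - C nu) = 0 := by
        apply Finset.prod_eq_zero (i := ev i)
        · refine Finset.mem_erase.2 ⟨hi, ?_⟩
          simpa [hs] using (hJ.mem_spectrum_iff (ev i)).2 ⟨i, rfl⟩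
        · simp
      simp only [this, zero_mul, mul_zero, Nat.cast_zero]
  simp only [hterm, ← Finset.sum_mul] at h0
  rw [← Nat.cast_sum] at h0
  have hprod : ∏ nu ∈ s.erase mu, (mu - nu) ≠ 0 := by
    rw [Finset.prod_ne_zero_iff]
    intro nu hnu
    exact sub_ne_zero.2 (Finset.ne_of_mem_erase hnu).symm
  obtain ⟨i, hi⟩ := (hJ.mem_spectrum_iff mu).1 (by simpa [hs] using hmu)
  have hsum : (∑ i, if ev i = mu then sz i else 0) ≠ 0 := by
    intro hz
    have := (Finset.sum_eq_zero_iff.1 hz) i (Finset.mem_univ _)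
    rw [if_pos hi] at this
    have := hJ.1 i
    omega
  rcases mul_eq_zero.1 h0 with h | h
  · exact absurd (Nat.cast_eq_zero.1 h) hsum
  · exact (mul_eq_zero.1 h).resolve_left hprod

theorem le_numEigenvalues_of_det_ne_zero {n m : ℕ} {Φ : Matrix (Fin n) (Fin n) ℂ}
    (h : (traceHankel m Φ).det ≠ 0) : m ≤ numEigenvalues Φ := by
  by_contra! hlt
  exact h (det_traceHankel_eq_zero Φ hlt)

/-- A rational expression in `Φ` for the nilpotent part of a matrix with `m` eigenvalues. -/
noncomputable def rationalNilpotentPart {n : ℕ} (m : ℕ) (Φ : Matrix (Fin n) (Fin n) ℂ) :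
    Matrix (Fin n) (Fin n) ℂ :=
  Φ ^ m - ∑ j : Fin m, ((traceHankel m Φ).det⁻¹ *
    ((traceHankel m Φ).updateCol j fun i => (Φ ^ ((i : ℕ) + m)).trace).det) • Φ ^ (j : ℕ)

theorem nilpotentPart_eq_rationalNilpotentPart {n : ℕ} (Φ : Matrix (Fin n) (Fin n) ℂ) :
    nilpotentPart Φ = rationalNilpotentPart (numEigenvalues Φ) Φ := by
  set m := numEigenvalues Φ with hm
  set H := traceHankel m Φ with hH
  have hdet : H.det ≠ 0 := det_traceHankel_ne_zero Φ rfl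
  set p := spectralPolynomial Φ
  have hdeg : p.natDegree = m := natDegree_spectralPolynomial Φ
  have hP : nilpotentPart Φ = Φ ^ m + ∑ j : Fin m, p.coeff j • Φ ^ (j : ℕ) := by
    rw [nilpotentPart, Polynomial.aeval_eq_sum_range, hdeg, Finset.sum_range_succ, add_comm,
      Fin.sum_univ_eq_sum_range (fun j => p.coeff j • Φ ^ j)]
    congr 1
    rw [← hdeg, (monic_spectralPolynomial Φ).coeff_natDegree, one_smul]
  -- The equations `tr (Φ ^ i * P) = 0` form a linear system for the lower coefficients of the
  -- spectral polynomial, to be solved by Cramer's rule.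
  have hlin : H.mulVec (fun j : Fin m => p.coeff j) = -fun i : Fin m => (Φ ^ ((i : ℕ) + m)).trace := by
    ext i
    have h := trace_mul_nilpotentPart Φ i
    rw [hP, mul_add, Matrix.trace_add, ← pow_add, Finset.mul_sum, Matrix.trace_sum] at h
    rw [Pi.neg_apply, eq_neg_iff_add_eq_zero, add_comm, ← h, Matrix.mulVec, dotProduct]
    congr 1
    refine Finset.sum_congr rfl fun j _ => ?_
    rw [mul_smul_comm, Matrix.trace_smul, ← pow_add, hH, traceHankel, Matrix.of_apply,
      smul_eq_mul, mul_comm]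
  have hcr : ∀ j : Fin m, p.coeff j =
      -(H.det⁻¹ * (H.updateCol j fun i => (Φ ^ ((i : ℕ) + m)).trace).det) := by
    intro j
    have h1 := congrArg (fun v => H.adjugate.mulVec v) hlin
    simp only [Matrix.mulVec_mulVec, Matrix.adjugate_mul, Matrix.smul_mulVec, Matrix.one_mulVec,
      Matrix.mulVec_neg] at h1
    rw [← Matrix.cramer_eq_adjugate_mulVec] at h1
    have h2 := congrFun h1 j
    simp only [Pi.smul_apply, smul_eq_mul, Pi.neg_apply, Matrix.cramer_apply] at h2
    rw [← mul_neg, ← h2, ← mul_assoc, inv_mul_cancel₀ hdet, one_mul]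
  rw [hP, rationalNilpotentPart, sub_eq_add_neg, ← Finset.sum_neg_distrib]
  congr 1
  refine Finset.sum_congr rfl fun j _ => ?_
  rw [hcr, neg_smul]

/-! ### Size of the nilpotent part, and rank in terms of minors. -/

theorem numEigenvalues_le {n : ℕ} (Φ : Matrix (Fin n) (Fin n) ℂ) : numEigenvalues Φ ≤ n := by
  have h : spectrum ℂ Φ = (Φ.charpoly.roots.toFinset : Set ℂ) := by
    ext mu
    simp [Matrix.mem_spectrum_iff_isRoot_charpoly, Φ.charpoly_monic.ne_zero]
  rw [numEigenvalues, h, Set.ncard_coe_finset]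
  refine (Multiset.toFinset_card_le _).trans ((Polynomial.card_roots' _).trans ?_)
  simp [Matrix.charpoly_natDegree_eq_dim]

theorem one_le_numEigenvalues {n : ℕ} (hn : 1 ≤ n) (Φ : Matrix (Fin n) (Fin n) ℂ) :
    1 ≤ numEigenvalues Φ := by
  have : Nonempty (Fin n) := ⟨⟨0, hn⟩⟩
  have := spectrum.nonempty_of_isAlgClosed_of_finiteDimensional ℂ Φ
  exact (Set.ncard_pos (Matrix.finite_spectrum Φ)).2 this

-- Eigenvalues are bounded by `‖Φ‖`, so each factor `Φ - mu` has norm at most `2‖Φ‖`. This bound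
-- survives where the nilpotent part is discontinuous.
open Polynomial in
theorem norm_nilpotentPart_le {n : ℕ} (hn : 1 ≤ n) (Φ : Matrix (Fin n) (Fin n) ℂ) :
    ‖nilpotentPart Φ‖ ≤ (2 * ‖Φ‖) ^ numEigenvalues Φ := by
  have : Nonempty (Fin n) := ⟨⟨0, hn⟩⟩
  have key : ∀ s : Finset ℂ, (∀ mu ∈ s, mu ∈ spectrum ℂ Φ) →
      ‖aeval Φ (∏ mu ∈ s, (X - C mu))‖ ≤ (2 * ‖Φ‖) ^ s.card := by
    classical
    intro s
    induction s using Finset.induction_on with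
    | empty => intro _; simp
    | insert mu s hmu ih =>
      intro h
      rw [Finset.prod_insert hmu, Finset.card_insert_of_notMem hmu, map_mul, pow_succ']
      refine (norm_mul_le _ _).trans (mul_le_mul ?_
        (ih fun nu hnu => h nu (Finset.mem_insert_of_mem hnu)) (norm_nonneg _) (by positivity))
      have h1 : ‖mu‖ ≤ ‖Φ‖ := spectrum.norm_le_norm_of_mem (h mu (Finset.mem_insert_self _ _))
      have h2 : ‖algebraMap ℂ (Matrix (Fin n) (Fin n) ℂ) mu‖ = ‖mu‖ := norm_algebraMap' _ mu
      simp only [map_sub, aeval_X, aeval_C]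
      linarith [norm_sub_le Φ (algebraMap ℂ (Matrix (Fin n) (Fin n) ℂ) mu)]
  rw [numEigenvalues_eq_card]
  exact key _ fun mu hmu => by simpa using hmu

theorem Matrix.exists_submatrix_det_ne_zero_of_le_rank {K : Type*} [Field K] {n r : ℕ}
    (M : Matrix (Fin n) (Fin n) K) (h : r ≤ M.rank) :
    ∃ f g : Fin r → Fin n, (M.submatrix f g).det ≠ 0 := by
  have cols : ∀ {a b : ℕ} (N : Matrix (Fin a) (Fin b) K), r ≤ N.rank →
      ∃ g : Fin r → Fin b, LinearIndependent K (N.submatrix id g).col := by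
    intro a b N hN
    obtain ⟨κ, φ, hφ, hspan, hli⟩ := exists_linearIndependent' K N.col
    have : Fintype κ := Fintype.ofInjective φ hφ
    have hc : r ≤ Fintype.card κ := by
      rw [Matrix.rank_eq_finrank_span_cols, ← hspan, finrank_span_eq_card hli] at hN
      exact hN
    obtain ⟨ψ⟩ : Nonempty (Fin r ↪ κ) := Function.Embedding.nonempty_of_card_le (by simpa using hc)
    exact ⟨fun i => φ (ψ i), hli.comp ψ ψ.injective⟩
  obtain ⟨g, hg⟩ := cols M h
  have hr : (M.submatrix id g).transpose.rank = r := by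
    rw [LinearIndependent.rank_matrix hg, Fintype.card_fin]
  obtain ⟨f, hf⟩ := cols _ hr.ge
  refine ⟨f, g, ?_⟩
  have hu : IsUnit (M.submatrix f g) := by
    rw [← Matrix.linearIndependent_rows_iff_isUnit]
    exact hf
  exact ((Matrix.isUnit_iff_isUnit_det _).1 hu).ne_zero

theorem Matrix.le_rank_of_submatrix_det_ne_zero {K : Type*} [Field K] {n r : ℕ}
    (M : Matrix (Fin n) (Fin n) K) (f g : Fin r → Fin n) (h : (M.submatrix f g).det ≠ 0) :
    r ≤ M.rank := by
  have := Matrix.rank_submatrix_le M f g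
  rwa [Matrix.rank_of_det_ne_zero h, Fintype.card_fin] at this

/-! ### Holomorphic functions of several variables. -/

/-- The identity theorem for holomorphic functions of several variables. -/
theorem DifferentiableOn.eqOn_zero_of_isPreconnected {E : Type*} [NormedAddCommGroup E]
    [NormedSpace ℂ E] {X : Set E} (hXo : IsOpen X) (hX : IsPreconnected X) {f : E → ℂ}
    (hf : DifferentiableOn ℂ f X) {z₀ : E} (hz₀ : z₀ ∈ X) (h₀ : f =ᶠ[𝓝 z₀] 0) :
    Set.EqOn f 0 X := by
  have hsub : X ⊆ {z | f =ᶠ[𝓝 z] 0} := by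
    refine hX.subset_of_closure_inter_subset isOpen_setOfPred_eventually_nhds ⟨z₀, hz₀, h₀⟩ ?_
    rintro z ⟨hzc, hzX⟩
    obtain ⟨r, hr, hball⟩ := Metric.isOpen_iff.1 hXo z hzX
    obtain ⟨w, hw, hwb⟩ := mem_closure_iff_nhds.1 hzc _ (Metric.ball_mem_nhds z hr)
    refine Filter.eventually_of_mem (Metric.ball_mem_nhds z hr) fun y hy => ?_
    -- The one-variable identity theorem is applied on the complex line joining a nearby point `w`,
    -- around which `f` vanishes, to `y`. The line meets the ball in a convex set.
    let ℓ : ℂ → E := fun t => w + t • (y - w)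
    have hℓ : Differentiable ℂ ℓ := by fun_prop
    let D : Set ℂ := ℓ ⁻¹' Metric.ball z r
    have hDo : IsOpen D := Metric.isOpen_ball.preimage hℓ.continuous
    have hDc : Convex ℝ D := by
      exact ((convex_ball z r).translate_preimage_right w).linear_preimage
        ((LinearMap.toSpanSingleton ℂ E (y - w)).restrictScalars ℝ)
    have hg : DifferentiableOn ℂ (f ∘ ℓ) D :=
      (hf.mono hball).comp hℓ.differentiableOn fun t ht => ht
    have h0 : (0 : ℂ) ∈ D := by simpa [D, ℓ] using hw
    have h1 : (1 : ℂ) ∈ D := by simpa [D, ℓ] using hy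
    have hev : f ∘ ℓ =ᶠ[𝓝 0] 0 := by
      have : Filter.Tendsto ℓ (𝓝 0) (𝓝 w) := by
        have := hℓ.continuous.tendsto 0
        simpa [ℓ] using this
      exact this.eventually hwb
    have := (hg.analyticOnNhd hDo).eqOn_zero_of_preconnected_of_eventuallyEq_zero
      hDc.isPreconnected h0 hev h1
    simpa [ℓ] using this
  exact fun z hz => (hsub hz).self_of_nhds

theorem DifferentiableOn.subset_closure_ne_zero {E : Type*} [NormedAddCommGroup E]
    [NormedSpace ℂ E] {X : Set E} (hXo : IsOpen X) (hX : IsPreconnected X) {f : E → ℂ}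
    (hf : DifferentiableOn ℂ f X) {z₀ : E} (hz₀ : z₀ ∈ X) (h₀ : f z₀ ≠ 0) :
    X ⊆ closure {z | z ∈ X ∧ f z ≠ 0} := by
  intro z hz
  by_contra hcon
  apply h₀
  refine hf.eqOn_zero_of_isPreconnected hXo hX hz ?_ hz₀
  have : (closure {z | z ∈ X ∧ f z ≠ 0})ᶜ ∩ X ∈ 𝓝 z :=
    Filter.inter_mem (isClosed_closure.isOpen_compl.mem_nhds hcon) (hXo.mem_nhds hz)
  filter_upwards [this] with y hy
  by_contra hne
  exact hy.1 (subset_closure ⟨hy.2, hne⟩)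

theorem DifferentiableOn.exists_prod_ne_zero {E ι : Type*} [NormedAddCommGroup E]
    [NormedSpace ℂ E] {X : Set E} (hXo : IsOpen X) (hX : IsConnected X) (s : Finset ι)
    (f : ι → E → ℂ) (hf : ∀ i, DifferentiableOn ℂ (f i) X) (h₀ : ∀ i, ∃ z ∈ X, f i z ≠ 0) :
    ∃ z ∈ X, ∀ i ∈ s, f i z ≠ 0 := by
  classical
  induction s using Finset.induction_on with
  | empty =>
    obtain ⟨z, hz⟩ := hX.nonempty
    exact ⟨z, hz, by simp⟩
  | insert a s ha ih =>
    obtain ⟨z, hz, hs⟩ := ih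
    obtain ⟨w, hw, hfw⟩ := h₀ a
    have hopen : {y | ∀ i ∈ s, f i y ≠ 0} ∈ 𝓝 z :=
      (Filter.eventually_all_finset s).2 fun i hi =>
        ((hf i).continuousOn.continuousAt (hXo.mem_nhds hz)).eventually_ne (hs i hi)
    obtain ⟨y, hy, hyX, hya⟩ := mem_closure_iff_nhds.1
      ((hf a).subset_closure_ne_zero hXo hX.isPreconnected hw hfw hz) _ hopen
    refine ⟨y, hyX, fun i hi => ?_⟩
    rcases Finset.mem_insert.1 hi with rfl | hi
    · exact hya
    · exact hy i hi

theorem tendsto_mul_zero_of_bounded {T : Type*} {l : Filter T} {u g : T → ℂ}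
    (hu : Filter.Tendsto u l (𝓝 0)) {K : ℝ} (hg : ∀ᶠ z in l, ‖g z‖ ≤ K) :
    Filter.Tendsto (fun z => u z * g z) l (𝓝 0) :=
  hu.zero_mul_isBoundedUnder_le ⟨K, by simpa using hg⟩

/-- A bounded function times the square of a differentiable function is differentiable at the zeros
of the latter. -/
theorem DifferentiableAt.sq_mul_of_bounded {E : Type*} [NormedAddCommGroup E] [NormedSpace ℂ E]
    {u g : E → ℂ} {x : E} (hu : DifferentiableAt ℂ u x) (hx : u x = 0) {K : ℝ}
    (hg : ∀ᶠ z in 𝓝 x, ‖g z‖ ≤ K) : DifferentiableAt ℂ (fun z => u z ^ 2 * g z) x := by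
  have hlim : Filter.Tendsto (fun z => u z * g z) (𝓝 x) (𝓝 0) :=
    tendsto_mul_zero_of_bounded (by simpa [hx] using hu.continuousAt.tendsto) hg
  have hO : u =O[𝓝 x] fun z => z - x := by
    have := hu.isBigO_sub
    simpa [hx] using this
  -- One factor `u` is `O(z - x)` and the other makes `u * g` tend to zero, so the derivative at `x`
  -- exists and is zero. A single factor `u` would not suffice.
  have ho : (fun z => u z * (u z * g z)) =o[𝓝 x] fun z => z - x := by
    have h1 : (fun z => u z * g z) =o[𝓝 x] fun _ => (1 : ℝ) :=
      (Asymptotics.isLittleO_one_iff ℝ).2 hlim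
    have := hO.norm_right.mul_isLittleO h1
    simpa using this
  have hd : HasFDerivAt (fun z => u z ^ 2 * g z) (0 : E →L[ℂ] ℂ) x := by
    rw [hasFDerivAt_iff_isLittleO]
    refine ho.congr_left fun z => ?_
    simp [hx]; ring
  exact hd.differentiableAt

theorem DifferentiableAt.prod_finset {E ι : Type*} [NormedAddCommGroup E] [NormedSpace ℂ E]
    {s : Finset ι} {f : ι → E → ℂ} {x : E} (h : ∀ i ∈ s, DifferentiableAt ℂ (f i) x) :
    DifferentiableAt ℂ (fun z => ∏ i ∈ s, f i z) x := by
  classical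
  exact (HasFDerivAt.finsetProd fun i hi => (h i hi).hasFDerivAt).differentiableAt

theorem DifferentiableAt.matrix_det {E : Type*} [NormedAddCommGroup E] [NormedSpace ℂ E] {m : ℕ}
    {M : E → Matrix (Fin m) (Fin m) ℂ} {x : E}
    (h : ∀ i j, DifferentiableAt ℂ (fun z => M z i j) x) :
    DifferentiableAt ℂ (fun z => (M z).det) x := by
  simp only [Matrix.det_apply]
  refine DifferentiableAt.fun_sum fun σ _ => DifferentiableAt.const_smul ?_ _
  exact DifferentiableAt.prod_finset fun i _ => h _ _

/-! ### Holomorphy and norm estimates for the matrix expressions. -/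

theorem differentiable_matrix_linearMap {n : ℕ} (L : Matrix (Fin n) (Fin n) ℂ →ₗ[ℂ] ℂ) :
    Differentiable ℂ fun Φ => L Φ :=
  (LinearMap.toContinuousLinearMap L).differentiable

theorem differentiable_trace_pow {n : ℕ} (k : ℕ) :
    Differentiable ℂ fun Φ : Matrix (Fin n) (Fin n) ℂ => (Φ ^ k).trace :=
  (differentiable_matrix_linearMap (Matrix.traceLinearMap (Fin n) ℂ ℂ)).comp
    (differentiable_id.pow k)

theorem differentiable_det_traceHankel {n : ℕ} (m : ℕ) :
    Differentiable ℂ fun Φ : Matrix (Fin n) (Fin n) ℂ => (traceHankel m Φ).det :=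
  fun _ => DifferentiableAt.matrix_det fun _ _ => differentiable_trace_pow _ _

theorem differentiableAt_rationalNilpotentPart {n m : ℕ} {Φ : Matrix (Fin n) (Fin n) ℂ}
    (h : (traceHankel m Φ).det ≠ 0) : DifferentiableAt ℂ (rationalNilpotentPart m) Φ := by
  unfold rationalNilpotentPart
  refine (differentiableAt_id.fun_pow m).fun_sub (DifferentiableAt.fun_sum fun j _ => ?_)
  refine DifferentiableAt.fun_smul (DifferentiableAt.fun_mul ?_ ?_) (differentiableAt_id.fun_pow _)
  · exact (differentiable_det_traceHankel m Φ).inv h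
  · refine DifferentiableAt.matrix_det fun i k => ?_
    simp only [Matrix.updateCol_apply]
    split_ifs
    · exact differentiable_trace_pow _ _
    · exact differentiable_trace_pow _ _

theorem differentiable_submatrix_det {n r : ℕ} (k : ℕ) (f g : Fin r → Fin n) :
    Differentiable ℂ fun Φ : Matrix (Fin n) (Fin n) ℂ => ((Φ ^ k).submatrix f g).det :=
  fun _ => DifferentiableAt.matrix_det fun i j =>
    ((differentiable_matrix_linearMap (Matrix.entryLinearMap ℂ ℂ (f i) (g j))).comp
      (differentiable_id.pow k)).differentiableAt

theorem norm_entry_le_l2_opNorm {n : ℕ} (Φ : Matrix (Fin n) (Fin n) ℂ) (i j : Fin n) :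
    ‖Φ i j‖ ≤ ‖Φ‖ := by
  have h := Matrix.l2_opNorm_mulVec Φ (EuclideanSpace.single j (1 : ℂ))
  rw [PiLp.norm_single, norm_one, mul_one] at h
  refine le_trans ?_ h
  refine le_trans (le_of_eq ?_) (PiLp.norm_apply_le _ i)
  simp

theorem norm_det_submatrix_le {n r : ℕ} (Φ : Matrix (Fin n) (Fin n) ℂ) (f g : Fin r → Fin n) :
    ‖(Φ.submatrix f g).det‖ ≤ r.factorial * ‖Φ‖ ^ r := by
  have h := Matrix.det_le (A := Φ.submatrix f g) (abv := NormedField.toAbsoluteValue ℂ) (x := ‖Φ‖)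
    fun i j => norm_entry_le_l2_opNorm Φ _ _
  rwa [Fintype.card_fin, nsmul_eq_mul] at h

theorem norm_trace_pow_le {n : ℕ} (hn : 1 ≤ n) (Φ : Matrix (Fin n) (Fin n) ℂ) (k : ℕ) :
    ‖(Φ ^ k).trace‖ ≤ n * ‖Φ‖ ^ k := by
  have : Nonempty (Fin n) := ⟨⟨0, hn⟩⟩
  refine (norm_sum_le _ _).trans ?_
  refine (Finset.sum_le_card_nsmul _ _ (‖Φ‖ ^ k) fun i _ => ?_).trans (by simp)
  exact (norm_entry_le_l2_opNorm _ _ _).trans (norm_pow_le _ _)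

theorem norm_det_traceHankel_le {n : ℕ} (hn : 1 ≤ n) (m : ℕ) (Φ : Matrix (Fin n) (Fin n) ℂ) :
    ‖(traceHankel m Φ).det‖ ≤ m.factorial * (n : ℝ) ^ m * ‖Φ‖ ^ (m * (m - 1)) := by
  rw [Matrix.det_apply]
  refine (norm_sum_le _ _).trans ?_
  refine (Finset.sum_le_card_nsmul _ _ ((n : ℝ) ^ m * ‖Φ‖ ^ (m * (m - 1))) fun σ _ => ?_).trans
    (by simp [Fintype.card_perm, mul_assoc])
  have h1 : ‖Equiv.Perm.sign σ • ∏ i, traceHankel m Φ (σ i) i‖ = ∏ i, ‖traceHankel m Φ (σ i) i‖ := by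
    rcases Int.units_eq_one_or (Equiv.Perm.sign σ) with h | h <;> simp [h]
  -- Every term of the determinant has the same degree in `Φ`.
  have h2 : ∑ i : Fin m, ((σ i : ℕ) + i) = m * (m - 1) := by
    rw [Finset.sum_add_distrib, Equiv.sum_comp σ fun i : Fin m => (i : ℕ), ← two_mul,
      Fin.sum_univ_eq_sum_range (fun i => i), mul_comm, Finset.sum_range_id_mul_two]
  rw [h1, ← h2, ← Finset.prod_pow_eq_pow_sum]
  calc ∏ i, ‖traceHankel m Φ (σ i) i‖ ≤ ∏ i : Fin m, ((n : ℝ) * ‖Φ‖ ^ ((σ i : ℕ) + i)) :=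
        Finset.prod_le_prod (fun _ _ => norm_nonneg _) fun i _ => norm_trace_pow_le hn Φ _
    _ = _ := by simp [Finset.prod_mul_distrib]

theorem numEigenvalues_eq_iff_det_ne_zero {n m : ℕ} {Φ : Matrix (Fin n) (Fin n) ℂ}
    (h : numEigenvalues Φ ≤ m) : (traceHankel m Φ).det ≠ 0 ↔ numEigenvalues Φ = m :=
  ⟨fun hd => le_antisymm h (le_numEigenvalues_of_det_ne_zero hd), det_traceHankel_ne_zero Φ⟩

theorem exists_bound_comp_nilpotentPart {n : ℕ} (hn : 1 ≤ n) {g : Matrix (Fin n) (Fin n) ℂ → ℂ}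
    (hg : Continuous g) (R : ℝ) : ∃ K, ∀ Φ, ‖Φ‖ ≤ R → ‖g (nilpotentPart Φ)‖ ≤ K := by
  have := FiniteDimensional.proper ℂ (Matrix (Fin n) (Fin n) ℂ)
  obtain ⟨K, hK⟩ := (isCompact_closedBall (0 : Matrix (Fin n) (Fin n) ℂ)
    ((1 + 2 * R) ^ n)).exists_bound_of_continuousOn hg.continuousOn
  refine ⟨K, fun Φ hΦ => hK _ ?_⟩
  rw [mem_closedBall_zero_iff]
  have h0 := norm_nonneg Φ
  calc ‖nilpotentPart Φ‖ ≤ (2 * ‖Φ‖) ^ numEigenvalues Φ := norm_nilpotentPart_le hn Φ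
    _ ≤ (1 + 2 * R) ^ numEigenvalues Φ := by gcongr; linarith
    _ ≤ (1 + 2 * R) ^ n := pow_le_pow_right₀ (by linarith) (numEigenvalues_le Φ)

/-! ### Regularized functions of the nilpotent part. -/

/-- The squared Hankel determinant compensates the discontinuities of the nilpotent part. -/
noncomputable def regularized {n : ℕ} (m : ℕ) (g : Matrix (Fin n) (Fin n) ℂ → ℂ)
    (Φ : Matrix (Fin n) (Fin n) ℂ) : ℂ :=
  (traceHankel m Φ).det ^ 2 * g (nilpotentPart Φ)

/-- The Hankel determinant stays nonzero nearby, so with at most `m` eigenvalues on `S` there are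
exactly `m`, and the rational formula applies. -/
theorem regularized_eventuallyEq {T : Type*} [TopologicalSpace T] {n m : ℕ} {S : Set T}
    {A : T → Matrix (Fin n) (Fin n) ℂ} (hm : ∀ z ∈ S, numEigenvalues (A z) ≤ m)
    {x : T} (hA : ContinuousWithinAt A S x) (hx : (traceHankel m (A x)).det ≠ 0)
    (g : Matrix (Fin n) (Fin n) ℂ → ℂ) :
    (fun z => regularized m g (A z)) =ᶠ[𝓝[S] x]
      fun z => (traceHankel m (A z)).det ^ 2 * g (rationalNilpotentPart m (A z)) := by
  have h1 := (((differentiable_det_traceHankel m).continuous.continuousAt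
    (x := A x)).comp_continuousWithinAt hA).eventually_ne hx
  filter_upwards [h1, self_mem_nhdsWithin] with z hz hzS
  have := (numEigenvalues_eq_iff_det_ne_zero (hm z hzS)).1 hz
  rw [regularized, nilpotentPart_eq_rationalNilpotentPart, this]

theorem exists_eventually_bound {T : Type*} [TopologicalSpace T] {n : ℕ} (hn : 1 ≤ n) {l : Filter T}
    {A : T → Matrix (Fin n) (Fin n) ℂ} {B : Matrix (Fin n) (Fin n) ℂ}
    (hA : Filter.Tendsto A l (𝓝 B))
    {g : Matrix (Fin n) (Fin n) ℂ → ℂ} (hg : Continuous g) :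
    ∃ K, ∀ᶠ z in l, ‖g (nilpotentPart (A z))‖ ≤ K := by
  obtain ⟨K, hK⟩ := exists_bound_comp_nilpotentPart hn hg (‖B‖ + 1)
  refine ⟨K, ?_⟩
  filter_upwards [hA.norm.eventually_lt_const (lt_add_one ‖B‖)] with z hz
  exact hK _ hz.le

theorem continuousOn_regularized {T : Type*} [TopologicalSpace T] {n m : ℕ} (hn : 1 ≤ n) {S : Set T}
    {A : T → Matrix (Fin n) (Fin n) ℂ} (hA : ContinuousOn A S)
    (hm : ∀ z ∈ S, numEigenvalues (A z) ≤ m) {g : Matrix (Fin n) (Fin n) ℂ → ℂ}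
    (hg : Continuous g) : ContinuousOn (fun z => regularized m g (A z)) S := by
  intro x hx
  have hD : ContinuousWithinAt (fun z => (traceHankel m (A z)).det) S x :=
    ((differentiable_det_traceHankel m).continuous.continuousAt
      (x := A x)).comp_continuousWithinAt (hA x hx)
  by_cases h0 : (traceHankel m (A x)).det = 0
  · obtain ⟨K, hK⟩ := exists_eventually_bound hn (hA x hx) hg
    have h1 : Filter.Tendsto (fun z => (traceHankel m (A z)).det ^ 2) (𝓝[S] x) (𝓝 0) := by
      simpa [h0] using hD.tendsto.pow 2
    have h2 : regularized m g (A x) = 0 := by simp [regularized, h0]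
    rw [ContinuousWithinAt, h2]
    exact tendsto_mul_zero_of_bounded h1 hK
  · refine ContinuousWithinAt.congr_of_eventuallyEq_of_mem ?_
      (regularized_eventuallyEq hm (hA x hx) h0 g) hx
    exact (hD.pow 2).mul (hg.continuousAt.comp_continuousWithinAt
      ((differentiableAt_rationalNilpotentPart h0).continuousAt.comp_continuousWithinAt (hA x hx)))

theorem differentiableOn_regularized {E : Type*} [NormedAddCommGroup E] [NormedSpace ℂ E] {n m : ℕ}
    (hn : 1 ≤ n) {X : Set E} (hX : IsOpen X) {A : E → Matrix (Fin n) (Fin n) ℂ}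
    (hA : DifferentiableOn ℂ A X) (hm : ∀ z ∈ X, numEigenvalues (A z) ≤ m)
    {g : Matrix (Fin n) (Fin n) ℂ → ℂ} (hg : Differentiable ℂ g) :
    DifferentiableOn ℂ (fun z => regularized m g (A z)) X := by
  intro x hx
  have hAx : DifferentiableAt ℂ A x := (hA x hx).differentiableAt (hX.mem_nhds hx)
  have hD : DifferentiableAt ℂ (fun z => (traceHankel m (A z)).det) x :=
    (differentiable_det_traceHankel m (A x)).comp x hAx
  apply DifferentiableAt.differentiableWithinAt
  by_cases h0 : (traceHankel m (A x)).det = 0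
  · obtain ⟨K, hK⟩ := exists_eventually_bound hn hAx.continuousAt.tendsto hg.continuous
    exact hD.sq_mul_of_bounded h0 hK
  · have heq := regularized_eventuallyEq hm hAx.continuousAt.continuousWithinAt h0 g
    rw [hX.nhdsWithin_eq hx] at heq
    refine DifferentiableAt.congr_of_eventuallyEq ?_ heq
    exact (hD.fun_pow 2).fun_mul
      ((hg _).comp x ((differentiableAt_rationalNilpotentPart h0).comp x hAx))

/-! ### Products of minors detecting the generic ranks. -/

/-- A selection of one `ρ k × ρ k` submatrix for each `k`. -/
abbrev MinorSelection {n : ℕ} (ρ : Fin n → ℕ) : Type :=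
  ∀ k, (Fin (ρ k) → Fin n) × (Fin (ρ k) → Fin n)

/-- The product of the selected minors of the powers `P, P², …, Pⁿ`. -/
noncomputable def minorProduct {n : ℕ} {ρ : Fin n → ℕ} (s : MinorSelection ρ)
    (P : Matrix (Fin n) (Fin n) ℂ) : ℂ :=
  ∏ k : Fin n, ((P ^ ((k : ℕ) + 1)).submatrix (s k).1 (s k).2).det

theorem differentiable_minorProduct {n : ℕ} {ρ : Fin n → ℕ} (s : MinorSelection ρ) :
    Differentiable ℂ (minorProduct s) :=
  fun _ => DifferentiableAt.prod_finset fun _ _ => differentiable_submatrix_det _ _ _ _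

theorem exists_minorProduct_ne_zero_iff {n : ℕ} {ρ : Fin n → ℕ} (P : Matrix (Fin n) (Fin n) ℂ) :
    (∃ s : MinorSelection ρ, minorProduct s P ≠ 0) ↔ ∀ k, ρ k ≤ (P ^ ((k : ℕ) + 1)).rank := by
  constructor
  · rintro ⟨s, hs⟩ k
    exact Matrix.le_rank_of_submatrix_det_ne_zero _ _ _
      (Finset.prod_ne_zero_iff.1 hs k (Finset.mem_univ k))
  · intro h
    choose f g hfg using fun k => Matrix.exists_submatrix_det_ne_zero_of_le_rank _ (h k)
    exact ⟨fun k => (f k, g k), Finset.prod_ne_zero_iff.2 fun k _ => hfg k⟩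

theorem exists_regularized_minorProduct_ne_zero_iff {n m : ℕ} {ρ : Fin n → ℕ}
    {Φ : Matrix (Fin n) (Fin n) ℂ} (hm : numEigenvalues Φ ≤ m) :
    (∃ s : MinorSelection ρ, regularized m (minorProduct s) Φ ≠ 0) ↔
      numEigenvalues Φ = m ∧ ∀ k, ρ k ≤ (nilpotentPart Φ ^ ((k : ℕ) + 1)).rank := by
  simp only [regularized, ne_eq, mul_eq_zero, not_or, pow_eq_zero_iff, OfNat.ofNat_ne_zero,
    not_false_eq_true, exists_and_left]
  rw [← numEigenvalues_eq_iff_det_ne_zero hm, ← exists_minorProduct_ne_zero_iff]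

theorem norm_minorProduct_le {n : ℕ} (hn : 1 ≤ n) {ρ : Fin n → ℕ} (s : MinorSelection ρ)
    (P : Matrix (Fin n) (Fin n) ℂ) :
    ‖minorProduct s P‖ ≤ (∏ k : Fin n, ((ρ k).factorial : ℝ)) * ‖P‖ ^ (∑ k : Fin n, ((k : ℕ) + 1) * ρ k) := by
  have : Nonempty (Fin n) := ⟨⟨0, hn⟩⟩
  rw [minorProduct, norm_prod, ← Finset.prod_pow_eq_pow_sum, ← Finset.prod_mul_distrib]
  refine Finset.prod_le_prod (fun _ _ => norm_nonneg _) fun k _ => ?_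
  refine (norm_det_submatrix_le _ _ _).trans ?_
  rw [pow_mul]
  gcongr
  exact norm_pow_le _ _

/-- The squared Hankel determinant has degree `2m(m - 1)`; a minor of size `ρ k` of `P ^ (k + 1)`
has degree `(k + 1) ρ k` in `P`, and `‖P‖` grows like `‖Φ‖ ^ m`. With fewer than `m` eigenvalues the
left side is zero. -/
theorem norm_regularized_minorProduct_le {n m : ℕ} (hn : 1 ≤ n) (ρ : Fin n → ℕ) :
    ∃ C : ℝ, 0 < C ∧ ∀ (s : MinorSelection ρ) (Φ : Matrix (Fin n) (Fin n) ℂ),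
      numEigenvalues Φ ≤ m → ‖regularized m (minorProduct s) Φ‖ ≤
        C * ‖Φ‖ ^ (2 * (m * (m - 1)) + m * ∑ k : Fin n, ((k : ℕ) + 1) * ρ k) := by
  set e := ∑ k : Fin n, ((k : ℕ) + 1) * ρ k with he
  have hfac : 0 < ∏ k : Fin n, ((ρ k).factorial : ℝ) :=
    Finset.prod_pos fun k _ => by exact_mod_cast Nat.factorial_pos _
  have hmf : (0 : ℝ) < m.factorial := by exact_mod_cast Nat.factorial_pos _
  have hn' : (0 : ℝ) < n := by exact_mod_cast hn
  refine ⟨(m.factorial * (n : ℝ) ^ m) ^ 2 * ((∏ k : Fin n, ((ρ k).factorial : ℝ)) * 2 ^ (m * e)),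
    by positivity, fun s Φ hΦ => ?_⟩
  by_cases hm : numEigenvalues Φ = m
  · have h1 := norm_det_traceHankel_le hn m Φ
    have h2 := norm_minorProduct_le hn s (nilpotentPart Φ)
    have h3 := norm_nilpotentPart_le hn Φ
    rw [hm] at h3
    rw [regularized, norm_mul, norm_pow]
    calc ‖(traceHankel m Φ).det‖ ^ 2 * ‖minorProduct s (nilpotentPart Φ)‖
        ≤ (m.factorial * (n : ℝ) ^ m * ‖Φ‖ ^ (m * (m - 1))) ^ 2 *
          ((∏ k : Fin n, ((ρ k).factorial : ℝ)) * ((2 * ‖Φ‖) ^ m) ^ e) := by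
          gcongr
          refine h2.trans ?_
          gcongr
      _ = _ := by
          rw [pow_add, mul_pow _ (‖Φ‖ ^ _), ← pow_mul, ← pow_mul, mul_pow 2 ‖Φ‖,
            mul_comm (m * (m - 1)) 2]
          ring
  · have h0 : (traceHankel m Φ).det = 0 := by
      by_contra h
      exact hm ((numEigenvalues_eq_iff_det_ne_zero hΦ).1 h)
    rw [regularized, h0]
    simp only [ne_eq, OfNat.ofNat_ne_zero, not_false_eq_true, zero_pow, zero_mul, norm_zero]
    positivity

theorem numJordanBlocks_congr_of_rank {n : ℕ} {Φ Ψ : Matrix (Fin n) (Fin n) ℂ}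
    (h : ∀ k : Fin n, (nilpotentPart Φ ^ ((k : ℕ) + 1)).rank =
      (nilpotentPart Ψ ^ ((k : ℕ) + 1)).rank) {l : ℕ} (hl : 1 ≤ l) :
    numJordanBlocks l Φ = numJordanBlocks l Ψ := by
  have hr : ∀ j, (nilpotentPart Φ ^ j).rank = (nilpotentPart Ψ ^ j).rank := by
    intro j
    rcases j with _ | j
    · simp
    · by_cases hj : j < n
      · exact h ⟨j, hj⟩
      · rw [rank_nilpotentPart_pow_of_le _ (by omega), rank_nilpotentPart_pow_of_le _ (by omega)]
  obtain ⟨l, rfl⟩ := Nat.exists_eq_add_of_le' hl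
  have h1 := numJordanBlocks_add_two_mul_rank Φ l
  have h2 := numJordanBlocks_add_two_mul_rank Ψ l
  rw [hr, hr l, hr (l + 2)] at h1
  omega

/-! ### Generic Jordan structure and the main theorem. -/

theorem Filter.Eventually.exists_mem_of_mem_closure {T : Type*} [TopologicalSpace T] {S Y : Set T}
    (hYS : Y ⊆ S) {x : T} (hx : x ∈ closure Y) {p : T → Prop} (hp : ∀ᶠ z in 𝓝[S] x, p z) :
    ∃ z ∈ Y, p z := by
  have := mem_closure_iff_nhdsWithin_neBot.1 hx
  obtain ⟨z, hz, hzY⟩ :=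
    ((hp.filter_mono (nhdsWithin_mono x hYS)).and self_mem_nhdsWithin).exists
  exact ⟨z, hzY, hz⟩

theorem nowhereDenseIn_diff {T : Type*} [TopologicalSpace T] {S G : Set T}
    (hopen : ∀ x ∈ S ∩ G, G ∈ 𝓝[S] x) (hdense : S ⊆ closure (S ∩ G)) :
    NowhereDenseIn S (S \ G) := by
  rw [NowhereDenseIn]
  refine (isClosed_isNowhereDense_iff_compl.2 ⟨?_, ?_⟩).2
  · rw [isOpen_iff_mem_nhds]
    rintro ⟨x, hx⟩ hxG
    have hxG' : x ∈ G := by simpa [hx] using hxG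
    have h := (preimage_coe_mem_nhds_subtype (a := ⟨x, hx⟩)).2 (hopen x ⟨hx, hxG'⟩)
    filter_upwards [h] with y hy
    simpa using hy
  · rintro ⟨x, hx⟩
    rw [closure_subtype]
    refine closure_mono ?_ (hdense hx)
    rintro y ⟨hyS, hyG⟩
    exact ⟨⟨y, hyS⟩, by simpa using hyG, rfl⟩

/-- The Jordan stable points are those where the number of eigenvalues and the ranks of the powers
of the nilpotent part take their generic values `m` and `ρ`. -/
theorem exists_generic_jordanStructure {E : Type*} [NormedAddCommGroup E] [NormedSpace ℂ E] {n : ℕ}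
    (hn : 1 ≤ n) {X : Set E} (hXo : IsOpen X) (hXc : IsConnected X)
    {A : E → Matrix (Fin n) (Fin n) ℂ} (hAc : ContinuousOn A (closure X))
    (hAh : DifferentiableOn ℂ A X) :
    ∃ (m : ℕ) (ρ : Fin n → ℕ), (∀ z ∈ closure X, numEigenvalues (A z) ≤ m) ∧ m ≤ n ∧
      (∀ k, ρ k ≤ n) ∧
      jordanStablePoints (closure X) A = {z | z ∈ closure X ∧ numEigenvalues (A z) = m ∧
        ∀ k, ρ k ≤ (nilpotentPart (A z) ^ ((k : ℕ) + 1)).rank} ∧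
      X ⊆ closure (X ∩ jordanStablePoints (closure X) A) := by
  have hmax : ∀ (Y : Set E) (f : E → ℕ), Y.Nonempty → (∀ z, f z ≤ n) →
      ∃ z ∈ Y, ∀ w ∈ Y, f w ≤ f z := by
    intro Y f hY hf
    have hb : BddAbove (f '' Y) := ⟨n, by rintro _ ⟨z, -, rfl⟩; exact hf z⟩
    obtain ⟨z, hz, hzf⟩ := Nat.sSup_mem (hY.image f) hb
    exact ⟨z, hz, fun w hw => by rw [hzf]; exact le_csSup hb ⟨w, hw, rfl⟩⟩
  obtain ⟨z₀, hz₀, hz₀max⟩ := hmax X (fun z => numEigenvalues (A z)) hXc.nonempty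
    fun z => numEigenvalues_le _
  set m := numEigenvalues (A z₀) with hm
  set S := closure X with hS
  have hXS : X ⊆ S := subset_closure
  have hmS : ∀ z ∈ S, numEigenvalues (A z) ≤ m := by
    intro z hz
    -- The number of eigenvalues is lower semicontinuous, so its maximum over `X` also bounds it on
    -- the closure.
    have h1 : ∀ᶠ w in 𝓝[S] z, (traceHankel (numEigenvalues (A z)) (A w)).det ≠ 0 :=
      (((differentiable_det_traceHankel _).continuous.continuousAt
        (x := A z)).comp_continuousWithinAt (hAc z hz)).eventually_ne (det_traceHankel_ne_zero _ rfl)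
    obtain ⟨w, hw, hwd⟩ := h1.exists_mem_of_mem_closure hXS hz
    exact (le_numEigenvalues_of_det_ne_zero hwd).trans (hz₀max w hw)
  -- Each rank is maximized separately, with its own maximizer `zk k`; that all maxima are attained
  -- at one point follows later from the identity theorem.
  choose zk hzk hzkmax using fun k : Fin n =>
    hmax {z | z ∈ X ∧ numEigenvalues (A z) = m}
      (fun z => (nilpotentPart (A z) ^ ((k : ℕ) + 1)).rank) ⟨z₀, hz₀, rfl⟩
      fun z => Matrix.rank_le_width _
  set ρ : Fin n → ℕ := fun k => (nilpotentPart (A (zk k)) ^ ((k : ℕ) + 1)).rank with hρ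
  have hminor : ∀ (k r : ℕ) (f g : Fin r → Fin n),
      Differentiable ℂ fun P : Matrix (Fin n) (Fin n) ℂ => ((P ^ k).submatrix f g).det :=
    fun k r f g => differentiable_submatrix_det k f g
  have hρS : ∀ z ∈ S, numEigenvalues (A z) = m → ∀ k : Fin n,
      (nilpotentPart (A z) ^ ((k : ℕ) + 1)).rank ≤ ρ k := by
    intro z hz hzm k
    obtain ⟨f, g, hfg⟩ := Matrix.exists_submatrix_det_ne_zero_of_le_rank
      (nilpotentPart (A z) ^ ((k : ℕ) + 1)) le_rfl
    -- A nonzero minor at a boundary point, once regularized, is continuous and hence nonzero at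
    -- some point of `X`, where the maximality of `ρ k` applies.
    have hne : regularized m (fun P => ((P ^ ((k : ℕ) + 1)).submatrix f g).det) (A z) ≠ 0 :=
      mul_ne_zero (pow_ne_zero _ (det_traceHankel_ne_zero _ hzm)) hfg
    have h1 := (continuousOn_regularized hn hAc hmS
      (hminor (k + 1) _ f g).continuous z hz).eventually_ne hne
    obtain ⟨w, hw, hwne⟩ := h1.exists_mem_of_mem_closure hXS hz
    have hwm : numEigenvalues (A w) = m :=
      (numEigenvalues_eq_iff_det_ne_zero (hmS w (hXS hw))).1 fun h => hwne (by simp [regularized, h])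
    have hwr := Matrix.le_rank_of_submatrix_det_ne_zero _ f g (right_ne_zero_of_mul hwne)
    exact hwr.trans (hzkmax k w ⟨hw, hwm⟩)
  set G : Set E := {z | z ∈ S ∧ numEigenvalues (A z) = m ∧
        ∀ k, ρ k ≤ (nilpotentPart (A z) ^ ((k : ℕ) + 1)).rank} with hG
  have hGiff : ∀ z ∈ S, z ∈ G ↔ ∃ s : MinorSelection ρ, regularized m (minorProduct s) (A z) ≠ 0 :=
    fun z hz => by
      rw [exists_regularized_minorProduct_ne_zero_iff (hmS z hz)]
      exact and_iff_right hz
  have hdense : X ⊆ closure (X ∩ G) := by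
    choose f g hfg using fun k => Matrix.exists_submatrix_det_ne_zero_of_le_rank
      (nilpotentPart (A (zk k)) ^ ((k : ℕ) + 1)) le_rfl
    obtain ⟨z, hz, hzne⟩ := DifferentiableOn.exists_prod_ne_zero hXo hXc Finset.univ
      (fun (k : Fin n) z => regularized m
        (fun P => ((P ^ ((k : ℕ) + 1)).submatrix (f k) (g k)).det) (A z))
      (fun k => differentiableOn_regularized hn hXo hAh (fun z hz => hmS z (hXS hz))
        (hminor _ _ _ _))
      (fun k => ⟨zk k, (hzk k).1,
        mul_ne_zero (pow_ne_zero _ (det_traceHankel_ne_zero _ (hzk k).2)) (hfg k)⟩)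
    have hzG : z ∈ G := by
      refine ⟨hXS hz, ?_, fun k => Matrix.le_rank_of_submatrix_det_ne_zero _ _ _
        (right_ne_zero_of_mul (hzne k (Finset.mem_univ k)))⟩
      refine (numEigenvalues_eq_iff_det_ne_zero (hmS z (hXS hz))).1 fun h =>
        -- Any factor shows that the Hankel determinant is nonzero; `n ≥ 1` provides one.
        hzne ⟨0, hn⟩ (Finset.mem_univ _) (by simp [regularized, h])
    obtain ⟨s, hs⟩ := (hGiff z (hXS hz)).1 hzG
    refine ((differentiableOn_regularized hn hXo hAh (fun z hz => hmS z (hXS hz))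
      (differentiable_minorProduct s)).subset_closure_ne_zero hXo hXc.isPreconnected hz hs).trans
      (closure_mono ?_)
    rintro w ⟨hw, hwne⟩
    exact ⟨hw, (hGiff w (hXS hw)).2 ⟨s, hwne⟩⟩
  have hopen : ∀ z ∈ G, G ∈ 𝓝[S] z := by
    intro z hz
    obtain ⟨s, hs⟩ := (hGiff z hz.1).1 hz
    filter_upwards [(continuousOn_regularized hn hAc hmS
      (differentiable_minorProduct s).continuous z hz.1).eventually_ne hs, self_mem_nhdsWithin]
      with w hw hwS
    exact (hGiff w hwS).2 ⟨s, hw⟩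
  have hJst : jordanStablePoints S A = G := by
    ext z
    constructor
    · rintro ⟨hz, hsplit, U, hU, hUJ⟩
      have hns : ∃ V ∈ 𝓝[S] z, ∀ w ∈ V ∩ S, numEigenvalues (A w) ≤ numEigenvalues (A z) := by
        by_contra! hcon
        exact hsplit ⟨hz, hcon⟩
      obtain ⟨V, hV, hVe⟩ := hns
      have hev : ∀ᶠ w in 𝓝[S] z, w ∈ U ∧ w ∈ V := Filter.Eventually.and hU hV
      have hzc : z ∈ closure (X ∩ G) := closure_minimal hdense isClosed_closure hz
      -- A stable point is compared with a nearby generic `w`: not splitting gives at least `m`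
      -- eigenvalues, and equal block counts give equal ranks.
      obtain ⟨w, hw, hwU, hwV⟩ := hev.exists_mem_of_mem_closure
        (Set.inter_subset_left.trans hXS) hzc
      refine ⟨hz, le_antisymm (hmS z hz) ?_, fun k => ?_⟩
      · rw [← hw.2.2.1]
        exact hVe w ⟨hwV, hw.2.1⟩
      · refine (hw.2.2.2 k).trans (le_of_eq ?_)
        rw [rank_nilpotentPart_pow_eq_sum, rank_nilpotentPart_pow_eq_sum]
        refine Finset.sum_congr rfl fun l hl => ?_
        rw [hUJ w ⟨hwU, hw.2.1⟩ l (Finset.mem_Icc.1 hl).1 (Finset.mem_Icc.1 hl).2]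
    · intro hz
      refine ⟨hz.1, ?_, G, hopen z hz, ?_⟩
      · rintro ⟨-, hsplit⟩
        obtain ⟨w, ⟨hwG, -⟩, hlt⟩ := hsplit G (hopen z hz)
        rw [hz.2.1, hwG.2.1] at hlt
        exact lt_irrefl _ hlt
      · rintro w ⟨hwG, -⟩ l hl -
        refine numJordanBlocks_congr_of_rank (fun k => ?_) hl
        rw [le_antisymm (hρS w hwG.1 hwG.2.1 k) (hwG.2.2 k),
          le_antisymm (hρS z hz.1 hz.2.1 k) (hz.2.2 k)]
  refine ⟨m, ρ, hmS, numEigenvalues_le _, fun k => Matrix.rank_le_width _, hJst, ?_⟩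
  rw [hJst]
  exact hdense

theorem stabilityDegree_le {n m : ℕ} (hm : m ≤ n) {ρ : Fin n → ℕ} (hρ : ∀ k, ρ k ≤ n) :
    2 * (m * (m - 1)) + m * ∑ k : Fin n, ((k : ℕ) + 1) * ρ k ≤ 2 * n ^ 4 := by
  have h1 : ∑ k : Fin n, ((k : ℕ) + 1) * ρ k ≤ n * (n * n) := by
    refine (Finset.sum_le_card_nsmul _ _ (n * n) fun k _ => Nat.mul_le_mul k.2 (hρ k)).trans ?_
    simp
  have h2 : m * ∑ k : Fin n, ((k : ℕ) + 1) * ρ k ≤ n ^ 4 :=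
    (Nat.mul_le_mul hm h1).trans (le_of_eq (by ring))
  have h3 : 2 * (m * (m - 1)) ≤ n ^ 4 := by
    have h4 : m * (m - 1) ≤ n * (n - 1) := Nat.mul_le_mul hm (by omega)
    have h5 : 2 * (n * (n - 1)) ≤ n ^ 4 := by
      rcases n with _ | n
      · simp
      · simp only [Nat.add_sub_cancel]
        nlinarith [Nat.zero_le (n ^ 4), Nat.zero_le (n ^ 3), Nat.zero_le (n ^ 2)]
    omega
  omega

theorem mainTheorem5 (N n : ℕ) (hn : 1 ≤ n)
    (X : Set (EuclideanSpace ℂ (Fin N))) (hXo : IsOpen X) (hXc : IsConnected X)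
    (hXb : HasC0Boundary X)
    (A : EuclideanSpace ℂ (Fin N) → Matrix (Fin n) (Fin n) ℂ)
    (hAc : ContinuousOn A (closure X)) (hAh : DifferentiableOn ℂ A X) :
    IsClosedAnalyticSubset X (X \ jordanStablePoints (closure X) A) ∧
    NowhereDenseIn X (X \ jordanStablePoints (closure X) A) ∧
    NowhereDenseIn (closure X) (closure X \ jordanStablePoints (closure X) A) ∧
    (jordanStablePoints (closure X) A ≠ closure X →
      ∃ (l : ℕ) (h : Fin l → EuclideanSpace ℂ (Fin N) → ℂ),
        (∀ j, ContinuousOn (h j) (closure X) ∧ DifferentiableOn ℂ (h j) X) ∧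
        closure X \ jordanStablePoints (closure X) A =
          {ζ | ζ ∈ closure X ∧ ∀ j, h j ζ = 0} ∧
        ∀ ζ ∈ closure X, ∀ j,
          ‖h j ζ‖ ≤ (2 * (n : ℝ)) ^ (2 * n ^ 4) * ‖A ζ‖ ^ (2 * n ^ 4)) := by
  obtain ⟨m, ρ, hmS, hmn, hρn, hJ, hdense⟩ := exists_generic_jordanStructure hn hXo hXc hAc hAh
  set S := closure X with hS
  set G := jordanStablePoints S A with hG
  have hXS : X ⊆ S := subset_closure
  have hGiff : ∀ z ∈ S, z ∈ G ↔ ∃ s : MinorSelection ρ, regularized m (minorProduct s) (A z) ≠ 0 :=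
    fun z hz => by
      rw [exists_regularized_minorProduct_ne_zero_iff (hmS z hz), hJ]
      exact and_iff_right hz
  have hcont : ∀ s : MinorSelection ρ,
      ContinuousOn (fun z => regularized m (minorProduct s) (A z)) S := fun s =>
    continuousOn_regularized hn hAc hmS (differentiable_minorProduct s).continuous
  have hdiff : ∀ s : MinorSelection ρ,
      DifferentiableOn ℂ (fun z => regularized m (minorProduct s) (A z)) X := fun s =>
    differentiableOn_regularized hn hXo hAh (fun z hz => hmS z (hXS hz))
      (differentiable_minorProduct s)
  have hopen : ∀ z ∈ S ∩ G, G ∈ 𝓝[S] z := by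
    rintro z ⟨hz, hzG⟩
    obtain ⟨s, hs⟩ := (hGiff z hz).1 hzG
    filter_upwards [(hcont s z hz).eventually_ne hs, self_mem_nhdsWithin] with w hw hwS
    exact (hGiff w hwS).2 ⟨s, hw⟩
  refine ⟨⟨Set.sdiff_subset, fun ξ hξ => ⟨X, hXo, hξ, subset_rfl, ?_⟩⟩, ?_, ?_, ?_⟩
  · let e := Fintype.equivFin (MinorSelection ρ)
    refine ⟨_, fun j z => regularized m (minorProduct (e.symm j)) (A z), fun j => hdiff _, ?_⟩
    ext z
    constructor
    · rintro ⟨⟨hz, hzG⟩, -⟩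
      refine ⟨hz, fun j => ?_⟩
      by_contra hne
      exact hzG ((hGiff z (hXS hz)).2 ⟨_, hne⟩)
    · rintro ⟨hz, hz0⟩
      refine ⟨⟨hz, fun hzG => ?_⟩, hz⟩
      obtain ⟨s, hs⟩ := (hGiff z (hXS hz)).1 hzG
      exact hs (by simpa using hz0 (e s))
  · exact nowhereDenseIn_diff
      (fun z hz => nhdsWithin_mono z hXS (hopen z ⟨hXS hz.1, hz.2⟩)) hdense
  · refine nowhereDenseIn_diff hopen ?_
    exact closure_minimal (hdense.trans (closure_mono (Set.inter_subset_inter_left _ hXS)))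
      isClosed_closure
  · intro hne
    obtain ⟨C, hC, hbound⟩ := norm_regularized_minorProduct_le (m := m) hn ρ
    set d := 2 * (m * (m - 1)) + m * ∑ k : Fin n, ((k : ℕ) + 1) * ρ k with hd
    have hd4 : d ≤ 2 * n ^ 4 := stabilityDegree_le hmn hρn
    -- The entries of `A` used below to raise the degree must not create new zeros. If `A` vanished
    -- at a stable point, then `m = 1` and all `ρ k = 0`, so every point would be stable, against
    -- the assumption.
    have hA0 : ∀ z ∈ G, A z ≠ 0 := by
      intro z hz h0
      apply hne
      have : Nonempty (Fin n) := ⟨⟨0, hn⟩⟩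
      rw [hJ] at hz
      obtain ⟨-, hz1, hz2⟩ := hz
      rw [h0] at hz1 hz2
      have hm1 : m = 1 := by
        rw [← hz1, numEigenvalues, spectrum.zero_eq, Set.ncard_singleton]
      have hP0 : nilpotentPart (0 : Matrix (Fin n) (Fin n) ℂ) = 0 := by
        have := norm_nilpotentPart_le hn (0 : Matrix (Fin n) (Fin n) ℂ)
        rw [hz1, hm1] at this
        simpa using this
      rw [hJ]
      ext w
      refine ⟨fun hw => hw.1, fun hw => ⟨hw, ?_, fun k => ?_⟩⟩
      · exact le_antisymm (hmS w hw) (hm1 ▸ one_le_numEigenvalues hn _)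
      · refine (hz2 k).trans ?_
        simp [hP0]
    let e := Fintype.equivFin (MinorSelection ρ × (Fin n × Fin n))
    -- Dividing by `C` normalizes the constant to one, and the power of an entry raises the degree
    -- from `d` to `2 * n ^ 4`. All entries are used, since at each stable point only some entry is
    -- known to be nonzero.
    let h : MinorSelection ρ × (Fin n × Fin n) → EuclideanSpace ℂ (Fin N) → ℂ := fun s z =>
      (C : ℂ)⁻¹ * regularized m (minorProduct s.1) (A z) * A z s.2.1 s.2.2 ^ (2 * n ^ 4 - d)
    have hentry : ∀ a b, Differentiable ℂ fun Φ : Matrix (Fin n) (Fin n) ℂ => Φ a b := fun a b =>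
      differentiable_matrix_linearMap (Matrix.entryLinearMap ℂ ℂ a b)
    have hCne : (C : ℂ)⁻¹ ≠ 0 := inv_ne_zero (by exact_mod_cast hC.ne')
    refine ⟨_, fun j => h (e.symm j), fun j => ⟨?_, ?_⟩, ?_, ?_⟩
    · exact (continuousOn_const.mul (hcont _)).mul
        (((hentry _ _).continuous.comp_continuousOn hAc).pow _)
    · exact ((hdiff _).const_mul _).mul
        (((hentry _ _).comp_differentiableOn hAh).pow _)
    · ext z
      constructor
      · rintro ⟨hz, hzG⟩
        refine ⟨hz, fun j => ?_⟩
        have : regularized m (minorProduct (e.symm j).1) (A z) = 0 := by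
          by_contra hne
          exact hzG ((hGiff z hz).2 ⟨_, hne⟩)
        simp [h, this]
      · rintro ⟨hz, hz0⟩
        refine ⟨hz, fun hzG => ?_⟩
        obtain ⟨s, hs⟩ := (hGiff z hz).1 hzG
        have hab : ∃ a b, A z a b ≠ 0 := by
          by_contra! hcon
          exact hA0 z hzG (Matrix.ext hcon)
        obtain ⟨a, b, hab⟩ := hab
        have h1 : h (e.symm (e (s, a, b))) z = 0 := hz0 _
        rw [Equiv.symm_apply_apply] at h1
        exact mul_ne_zero (mul_ne_zero hCne hs) (pow_ne_zero _ hab) h1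
    · intro z hz j
      have h1 := hbound (e.symm j).1 (A z) (hmS z hz)
      have h2 := norm_entry_le_l2_opNorm (A z) (e.symm j).2.1 (e.symm j).2.2
      have hn1 : (1 : ℝ) ≤ (2 * (n : ℝ)) ^ (2 * n ^ 4) := by
        apply one_le_pow₀
        have : (1 : ℝ) ≤ n := by exact_mod_cast hn
        linarith
      have hCn : ‖(C : ℂ)⁻¹‖ = C⁻¹ := by
        rw [norm_inv, Complex.norm_real, Real.norm_of_nonneg hC.le]
      calc ‖h (e.symm j) z‖ = C⁻¹ * ‖regularized m (minorProduct (e.symm j).1) (A z)‖ *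
            ‖A z (e.symm j).2.1 (e.symm j).2.2‖ ^ (2 * n ^ 4 - d) := by
            simp only [h, norm_mul, norm_pow, hCn]
        _ ≤ C⁻¹ * (C * ‖A z‖ ^ d) * ‖A z‖ ^ (2 * n ^ 4 - d) := by gcongr
        _ = ‖A z‖ ^ (2 * n ^ 4) := by
            rw [← mul_assoc, inv_mul_cancel₀ hC.ne', one_mul, ← pow_add,
              Nat.add_sub_cancel' hd4]
        -- The normalized functions already satisfy the bound with constant one, and `(2n) ^ (2n⁴) ≥
        -- 1`.
        _ ≤ _ := le_mul_of_one_le_left (by positivity) hn1
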